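/- All graphs are finite and simple; $P_n$ is the path on $n$ vertices, $G_1+G_2$ is the disjoint union of graphs, $3P_1=P_1+P_1+P_1$, and a graph is $H$-free if it has no induced subgraph isomorphic to $H$. Disjoint Paths: given a graph $G$ and pairwise disjoint terminal pairs $(s_1,t_1),\dots,(s_k,t_k)$ of vertices of $G$ (disjoint meaning $\{s_i,t_i\}\cap\{s_j,t_j\}=\emptyset$ for $i\ne j$; $k$ is part of the input), does $G$ have pairwise vertex-disjoint paths $P^1,\dots,P^k$ such that $P^i$ is an $s_i$-$t_i$-path for every $i$? Disjoint Connected Subgraphs: given a graph $G$ and pairwise disjoint nonempty terminal sets $Z_1,\dots,Z_k\subseteq V(G)$ ($k$ is part of the input), does $G$ have pairwise disjoint sets $S_1,\dots,S_k\subseteq V(G)$ such that $Z_i\subseteq S_i$ and $G[S_i]$ is connected for every $i$? Two decision problems are polynomially equivalent if each of them can be reduced to the other by a polynomial-time many-one reduction, that is, by a polynomial-time computable map from instances to instances that preserves both yes-instances and no-instances. **Proposition.** Disjoint Paths restricted to $(P_1+P_3)$-free graphs and Disjoint Connected Subgraphs restricted to $(P_1+P_3)$-free graphs are both polynomially equivalent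 to Disjoint Paths restricted to $3P_1$-free graphs. -/

import Mathlib

/-! ### Polynomial-time computation

The machine model is a WHILE language over binary trees (Lisp data) with an explicit running time.
Trees play the role of words over a finite alphabet. Every instruction is charged the size of the
tree that it is applied to, so no instruction builds or copies anything for free: a run of time `t`
only ever handles trees of size at most `t`, and running times agree up to a polynomial with those
of Turing machines. -/

/-- Binary trees, the data on which programs work. -/
inductive Data : Type
  | nil : Data
  | cons (a b : Data) : Data

namespace Data

/-- The number of nodes of a tree (leaves included). -/
def size : Data → ℕ
  | nil => 1
  | cons a b => a.size + b.size + 1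

/-- First component, with `hd nil = nil`. -/
def hd : Data → Data
  | nil => nil
  | cons a _ => a

/-- Second component, with `tl nil = nil`. -/
def tl : Data → Data
  | nil => nil
  | cons _ b => b

/-- A list of trees as a tree. -/
def ofList : List Data → Data
  | [] => nil
  | a :: l => cons a (ofList l)

/-- A truth value as a tree: `nil` is false. -/
def ofBool : Bool → Data
  | false => nil
  | true => cons nil nil

/-- A natural number in unary, as a list of `n` leaves. -/
def ofNat (n : ℕ) : Data := ofList (List.replicate n nil)

theorem ofList_injective : Function.Injective ofList := by
  intro l
  induction l with
  | nil => intro l' h; cases l' <;> simp_all [ofList]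
  | cons a l ih =>
    intro l' h
    cases l' with
    | nil => simp [ofList] at h
    | cons b l' =>
      simp only [ofList, cons.injEq] at h
      rw [h.1, ih h.2]

theorem ofBool_injective : Function.Injective ofBool := by
  intro a b h
  cases a <;> cases b <;> simp_all [ofBool]

theorem ofNat_injective : Function.Injective ofNat := by
  intro m n h
  simpa using congrArg List.length (ofList_injective h)

theorem ofList_ofFn_length {m n : ℕ} {f : Fin m → Data} {g : Fin n → Data}
    (h : ofList (List.ofFn f) = ofList (List.ofFn g)) : m = n := by
  simpa using congrArg List.length (ofList_injective h)

theorem ofList_ofFn_injective {n : ℕ} {f g : Fin n → Data}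
    (h : ofList (List.ofFn f) = ofList (List.ofFn g)) : f = g :=
  List.ofFn_injective (ofList_injective h)

end Data

/-- Programs. A program transforms one tree into another one. -/
inductive Code : Type
  /-- return `nil` -/
  | nil : Code
  /-- return the input -/
  | ident : Code
  /-- return the first component of the input -/
  | hd : Code
  /-- return the second component of the input -/
  | tl : Code
  /-- run both programs on the input and return the pair of their results -/
  | pair (f g : Code) : Code
  /-- run `f`, then run `g` on its result -/
  | seq (f g : Code) : Code
  /-- if the result of `c` on the input is not `nil` run `f`, else run `g`, on the input -/
  | ite (c f g : Code) : Code
  /-- while the result of `c` on the current tree is not `nil`, replace that tree by the result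
  of `f` on it -/
  | loop (c f : Code) : Code

/-- `Run c x y t`: the program `c`, started on `x`, halts with result `y` after time `t`. -/
inductive Code.Run : Code → Data → Data → ℕ → Prop
  | nil (x : Data) : Code.Run Code.nil x Data.nil x.size
  | ident (x : Data) : Code.Run Code.ident x x x.size
  | hd (x : Data) : Code.Run Code.hd x x.hd x.size
  | tl (x : Data) : Code.Run Code.tl x x.tl x.size
  | pair {f g : Code} {x y z : Data} {m n : ℕ} :
      Code.Run f x y m → Code.Run g x z n →
      Code.Run (Code.pair f g) x (Data.cons y z) (x.size + m + n)
  | seq {f g : Code} {x y z : Data} {m n : ℕ} :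
      Code.Run f x y m → Code.Run g y z n →
      Code.Run (Code.seq f g) x z (x.size + m + n)
  | ite_true {c f g : Code} {x b y : Data} {m n : ℕ} :
      Code.Run c x b m → b ≠ Data.nil → Code.Run f x y n →
      Code.Run (Code.ite c f g) x y (x.size + m + n)
  | ite_false {c f g : Code} {x y : Data} {m n : ℕ} :
      Code.Run c x Data.nil m → Code.Run g x y n →
      Code.Run (Code.ite c f g) x y (x.size + m + n)
  | loop_done {c f : Code} {x : Data} {m : ℕ} :
      Code.Run c x Data.nil m →
      Code.Run (Code.loop c f) x x (x.size + m)
  | loop_step {c f : Code} {x b y z : Data} {m n p : ℕ} :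
      Code.Run c x b m → b ≠ Data.nil → Code.Run f x y n → Code.Run (Code.loop c f) y z p →
      Code.Run (Code.loop c f) x z (x.size + m + n + p)

/-- The function `f` is computable in polynomial time, with respect to the given encodings of its
arguments and values: one program computes it, in time bounded by a polynomial in the size of the
encoded argument. -/
def PolyTimeComputable {α β : Type} (encα : α → Data) (encβ : β → Data) (f : α → β) : Prop :=
  ∃ (c : Code) (p : Polynomial ℕ), ∀ a : α,
    ∃ t : ℕ, t ≤ p.eval (encα a).size ∧ Code.Run c (encα a) (encβ (f a)) t

/-! ### Decision problems and reductions -/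

/-- A decision problem: its instances, their encoding, and the set of yes-instances. -/
structure DecisionProblem where
  Instance : Type
  encode : Instance → Data
  encode_injective : Function.Injective encode
  Yes : Instance → Prop

namespace DecisionProblem

/-- The problem with its inputs restricted to the instances that satisfy `C`. -/
def restrict (A : DecisionProblem) (C : A.Instance → Prop) : DecisionProblem where
  Instance := {I : A.Instance // C I}
  encode I := A.encode I.1
  encode_injective := fun _ _ h => Subtype.ext (A.encode_injective h)
  Yes I := A.Yes I.1

/-- Polynomial-time many-one reducibility: a polynomial-time computable function maps every
instance of `A` to an equivalent instance of `B`. -/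
def PolyReducesTo (A B : DecisionProblem) : Prop :=
  ∃ f : A.Instance → B.Instance,
    PolyTimeComputable A.encode B.encode f ∧ ∀ I : A.Instance, A.Yes I ↔ B.Yes (f I)

/-- Polynomial equivalence: each problem reduces to the other one in polynomial time. -/
def PolyEquivalent (A B : DecisionProblem) : Prop :=
  A.PolyReducesTo B ∧ B.PolyReducesTo A

end DecisionProblem

/-! ### The two problems

Input graphs are finite simple graphs with vertex set `Fin n`, given by their adjacency matrix. -/

open Classical in
/-- A graph on `Fin n`, encoded as the list of the rows of its adjacency matrix. -/
noncomputable def encodeGraph {n : ℕ} (G : SimpleGraph (Fin n)) : Data :=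
  Data.ofList (List.ofFn fun u : Fin n =>
    Data.ofList (List.ofFn fun v : Fin n => Data.ofBool (decide (G.Adj u v))))

theorem encodeGraph_order {m n : ℕ} {G : SimpleGraph (Fin m)} {H : SimpleGraph (Fin n)}
    (h : encodeGraph G = encodeGraph H) : m = n :=
  Data.ofList_ofFn_length h

theorem encodeGraph_injective {n : ℕ} :
    Function.Injective (encodeGraph : SimpleGraph (Fin n) → Data) := by
  intro G H h
  ext u v
  have h1 := congrFun (Data.ofList_ofFn_injective h) u
  have h2 := Data.ofBool_injective (congrFun (Data.ofList_ofFn_injective h1) v)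
  simpa using h2

/-- An instance of Disjoint Paths: a graph and pairwise disjoint terminal pairs. -/
structure DisjointPathsInstance where
  n : ℕ
  G : SimpleGraph (Fin n)
  k : ℕ
  s : Fin k → Fin n
  t : Fin k → Fin n
  disjoint : Pairwise fun i j => Disjoint ({s i, t i} : Finset (Fin n)) {s j, t j}

/-- An instance of Disjoint Connected Subgraphs: a graph and pairwise disjoint (nonempty) terminal
sets. -/
structure DisjointConnectedSubgraphsInstance where
  n : ℕ
  G : SimpleGraph (Fin n)
  k : ℕ
  Z : Fin k → Finset (Fin n)
  nonempty : ∀ i, (Z i).Nonempty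
  disjoint : Pairwise fun i j => Disjoint (Z i) (Z j)

/-- Disjoint Paths: are there pairwise vertex-disjoint paths, the `i`-th one from `s i` to `t i`?
The terminal pairs are encoded as a list of pairs of vertices. -/
noncomputable def disjointPaths : DecisionProblem where
  Instance := DisjointPathsInstance
  encode I := Data.cons (encodeGraph I.G)
    (Data.ofList (List.ofFn fun i => Data.cons (Data.ofNat (I.s i)) (Data.ofNat (I.t i))))
  encode_injective := by
    rintro ⟨n, G, k, s, t, hd⟩ ⟨n', G', k', s', t', hd'⟩ h
    simp only [Data.cons.injEq] at h
    obtain ⟨hG, hT⟩ := h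
    obtain rfl := encodeGraph_order hG
    obtain rfl := Data.ofList_ofFn_length hT
    obtain rfl := encodeGraph_injective hG
    have key := fun i => congrFun (Data.ofList_ofFn_injective hT) i
    simp only [Data.cons.injEq] at key
    obtain rfl : s = s' := funext fun i => Fin.ext (Data.ofNat_injective (key i).1)
    obtain rfl : t = t' := funext fun i => Fin.ext (Data.ofNat_injective (key i).2)
    rfl
  Yes I := ∃ P : ∀ i : Fin I.k, I.G.Path (I.s i) (I.t i),
    Pairwise fun i j => (P i).1.support.Disjoint (P j).1.support

/-- Disjoint Connected Subgraphs: are there pairwise disjoint connected vertex sets, the `i`-th one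
containing `Z i`? The terminal sets are encoded as a list of 0-1 vectors indexed by the vertices. -/
noncomputable def disjointConnectedSubgraphs : DecisionProblem where
  Instance := DisjointConnectedSubgraphsInstance
  encode I := Data.cons (encodeGraph I.G)
    (Data.ofList (List.ofFn fun i =>
      Data.ofList (List.ofFn fun v : Fin I.n => Data.ofBool (decide (v ∈ I.Z i)))))
  encode_injective := by
    rintro ⟨n, G, k, Z, hn, hd⟩ ⟨n', G', k', Z', hn', hd'⟩ h
    simp only [Data.cons.injEq] at h
    obtain ⟨hG, hT⟩ := h
    obtain rfl := encodeGraph_order hG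
    obtain rfl := Data.ofList_ofFn_length hT
    obtain rfl := encodeGraph_injective hG
    have key := fun i v => Data.ofBool_injective
      (congrFun (Data.ofList_ofFn_injective (congrFun (Data.ofList_ofFn_injective hT) i)) v)
    obtain rfl : Z = Z' := by
      funext i
      ext v
      simpa using key i v
    rfl
  Yes I := ∃ S : Fin I.k → Finset (Fin I.n),
    (Pairwise fun i j => Disjoint (S i) (S j)) ∧
      ∀ i, (I.G.induce (S i : Set (Fin I.n))).Connected ∧ I.Z i ⊆ S i

/-! ### Graph classes -/

/-- `G` is `H`-free: it does not contain `H` as an induced subgraph. -/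
def IsHFree {W V : Type} (H : SimpleGraph W) (G : SimpleGraph V) : Prop :=
  ¬ SimpleGraph.IsIndContained H G

/-- The path on `n` vertices. -/
abbrev pathOn (n : ℕ) : SimpleGraph (Fin n) := SimpleGraph.pathGraph n

/-- The graph `3P₁`, the disjoint union of three one-vertex paths. -/
def graph3P1 : SimpleGraph ((Fin 1 ⊕ Fin 1) ⊕ Fin 1) :=
  SimpleGraph.sum (SimpleGraph.sum (pathOn 1) (pathOn 1)) (pathOn 1)

/-- The graph `P₁ + P₃`. -/
def graphP1P3 : SimpleGraph (Fin 1 ⊕ Fin 3) :=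
  SimpleGraph.sum (pathOn 1) (pathOn 3)

/-- Disjoint Paths on `H`-free graphs. -/
noncomputable def disjointPathsOn {W : Type} (H : SimpleGraph W) : DecisionProblem :=
  disjointPaths.restrict fun I => IsHFree H (DisjointPathsInstance.G I)

/-- Disjoint Connected Subgraphs on `H`-free graphs. -/
noncomputable def disjointConnectedSubgraphsOn {W : Type} (H : SimpleGraph W) : DecisionProblem :=
  disjointConnectedSubgraphs.restrict fun I =>
    IsHFree H (DisjointConnectedSubgraphsInstance.G I)

/-! ### Polynomial-time programs -/

/-! Two reductions are immediate: `3P₁` is induced in `P₁ + P₃`, so `3P₁`-free graphs are `(P₁ +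
P₃)`-free, and a terminal pair is a terminal set with at most two vertices. Everything rests on
reducing Disjoint Connected Subgraphs on `(P₁ + P₃)`-free graphs to Disjoint Paths on `3P₁`-free
graphs.

The complement of `P₁ + P₃` is the paw, and a component of a paw-free graph is triangle-free or
complete multipartite. Hence `G` is a join of pieces, each `3P₁`-free or a disjoint union of at
least three cliques. `InTriad` picks out the vertices in pieces of the second kind, where `CoClose`
means lying in the same piece (`InTriad.adj_of_not`, `adj_of_not_coClose`, `CoClose.trans`,
`adj_trans_of_coClose`).

A terminal set containing an induced `P₃` is connected, because the `P₃` dominates it. Any other set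
is a disjoint union of cliques; if there are at least two, it is split and yields a pair `s`, `t`
from different cliques. Every other terminal becomes a trivial pair, which merely blocks its vertex.
In `pathReduction` a piece with triads turns into two cliques, targets and non-targets, still joined
to all the rest; outside the triads, a nonterminal that sees a clique of a split set becomes
adjacent to that whole clique. The result is `3P₁`-free (`pathReduction_triad`).

A split set in a piece with triads can be connected only by using a vertex outside the piece, and
one such vertex suffices; the same holds for an `s`-`t` path in the new graph. A split set outside
the triads has exactly two cliques, which can be contracted to `s` and `t`, and a single triad
vertex would also connect it (`exists_pathReduction_walk`,
`exists_connected_of_pathReduction_walk`). The new graph and pairs are defined by boundedly many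
quantifiers over vertices and set indices, so exhaustive search computes them in polynomial time. -/

theorem Code.Run.size_le {c : Code} {x y : Data} {t : ℕ} (h : Code.Run c x y t) : y.size ≤ t := by
  have pos : ∀ d : Data, 1 ≤ d.size := fun d => by cases d <;> simp [Data.size]
  induction h with
  | nil x => exact pos x
  | ident x => exact le_rfl
  | hd x => cases x <;> simp [Data.hd, Data.size]; omega
  | tl x => cases x <;> simp [Data.tl, Data.size]; omega
  | @pair f g x y z m n _ _ _ _ => have := pos x; simp only [Data.size]; omega
  | seq => omega
  | ite_true => omega
  | ite_false => omega
  | loop_done => omega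
  | loop_step => omega

theorem Polynomial.eval_mono_nat (p : Polynomial ℕ) {m n : ℕ} (h : m ≤ n) :
    p.eval m ≤ p.eval n := by
  rw [Polynomial.eval_eq_sum_range, Polynomial.eval_eq_sum_range]
  exact Finset.sum_le_sum fun i _ => Nat.mul_le_mul_left _ (Nat.pow_le_pow_left h i)

/-- One program turns `D a` into `E a` in polynomial time, for every `a`. -/
def Transforms {ι : Type} (D E : ι → Data) : Prop :=
  ∃ (c : Code) (p : Polynomial ℕ), ∀ a : ι, ∃ t ≤ p.eval (D a).size, Code.Run c (D a) (E a) t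

/-! ### Closure properties of polynomial-time transformations -/

namespace Transforms

variable {ι κ : Type} {D E F : ι → Data}

theorem refl (D : ι → Data) : Transforms D D :=
  ⟨Code.ident, Polynomial.X, fun a => ⟨_, by simp, Code.Run.ident _⟩⟩

theorem nil (D : ι → Data) : Transforms D fun _ => Data.nil :=
  ⟨Code.nil, Polynomial.X, fun a => ⟨_, by simp, Code.Run.nil _⟩⟩

theorem trans (h : Transforms D E) (h' : Transforms E F) : Transforms D F := by
  obtain ⟨c, p, hc⟩ := h
  obtain ⟨c', p', hc'⟩ := h'
  refine ⟨Code.seq c c', Polynomial.X + p + p'.comp p, fun a => ?_⟩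
  obtain ⟨t, ht, hr⟩ := hc a
  obtain ⟨t', ht', hr'⟩ := hc' a
  refine ⟨_, ?_, Code.Run.seq hr hr'⟩
  -- The second program starts on a tree no larger than the first running time, whence `p'.comp p`.
  have := p'.eval_mono_nat (hr.size_le.trans ht)
  simp only [Polynomial.eval_add, Polynomial.eval_X, Polynomial.eval_comp]
  omega

theorem pair (h : Transforms D E) (h' : Transforms D F) :
    Transforms D fun a => Data.cons (E a) (F a) := by
  obtain ⟨c, p, hc⟩ := h
  obtain ⟨c', p', hc'⟩ := h'
  refine ⟨Code.pair c c', Polynomial.X + p + p', fun a => ?_⟩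
  obtain ⟨t, ht, hr⟩ := hc a
  obtain ⟨t', ht', hr'⟩ := hc' a
  refine ⟨_, ?_, Code.Run.pair hr hr'⟩
  simp only [Polynomial.eval_add, Polynomial.eval_X]
  omega

theorem hd (h : Transforms D E) : Transforms D fun a => (E a).hd :=
  h.trans ⟨Code.hd, Polynomial.X, fun a => ⟨_, by simp, Code.Run.hd _⟩⟩

theorem tl (h : Transforms D E) : Transforms D fun a => (E a).tl :=
  h.trans ⟨Code.tl, Polynomial.X, fun a => ⟨_, by simp, Code.Run.tl _⟩⟩

theorem comap (h : Transforms D E) (g : κ → ι) : Transforms (fun a => D (g a)) fun a => E (g a) :=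
  let ⟨c, p, hc⟩ := h
  ⟨c, p, fun a => hc (g a)⟩

theorem const (D : ι → Data) (d : Data) : Transforms D fun _ => d := by
  induction d with
  | nil => exact nil D
  | cons a b ha hb => exact ha.pair hb

theorem ite {b : ι → Bool} (hb : Transforms D fun a => Data.ofBool (b a)) (h : Transforms D E)
    (h' : Transforms D F) : Transforms D fun a => if b a then E a else F a := by
  obtain ⟨c, p, hc⟩ := h
  obtain ⟨c', p', hc'⟩ := h'
  obtain ⟨cb, pb, hcb⟩ := hb
  refine ⟨Code.ite cb c c', Polynomial.X + pb + p + p', fun a => ?_⟩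
  obtain ⟨t, ht, hr⟩ := hc a
  obtain ⟨t', ht', hr'⟩ := hc' a
  obtain ⟨s, hs, hrs⟩ := hcb a
  simp only [Polynomial.eval_add, Polynomial.eval_X]
  beta_reduce at hrs
  cases hba : b a with
  | true =>
    rw [hba] at hrs
    exact ⟨_, by omega, Code.Run.ite_true hrs (by simp [Data.ofBool]) hr⟩
  | false =>
    rw [hba] at hrs
    exact ⟨_, by omega, Code.Run.ite_false hrs hr'⟩

end Transforms

/-- Types whose elements are represented by trees. -/
class Encoded (α : Type) where
  enc : α → Data

open Encoded (enc)

instance : Encoded Bool := ⟨Data.ofBool⟩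
instance : Encoded ℕ := ⟨Data.ofNat⟩
instance {α : Type} [Encoded α] : Encoded (List α) := ⟨fun l => Data.ofList (l.map enc)⟩
instance {α β : Type} [Encoded α] [Encoded β] : Encoded (α × β) :=
  ⟨fun p => Data.cons (enc p.1) (enc p.2)⟩
instance {α : Type} {β : α → Type} [Encoded α] [∀ a, Encoded (β a)] : Encoded (Σ a, β a) :=
  ⟨fun p => Data.cons (enc p.1) (enc p.2)⟩

/-- Computability in polynomial time with respect to the standard encodings. -/
def PolyTime {α : Type} {β : α → Type} [Encoded α] [∀ a, Encoded (β a)] (f : ∀ a, β a) : Prop :=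
  Transforms enc fun a => enc (f a)

theorem enc_length_le {α : Type} [Encoded α] (l : List α) : l.length ≤ (enc l).size := by
  induction l with
  | nil => simp
  | cons a l ih =>
    change _ ≤ (enc a).size + (enc l).size + 1
    simp only [List.length_cons]
    omega

theorem enc_cons {α : Type} [Encoded α] (a : α) (l : List α) :
    enc (a :: l) = Data.cons (enc a) (enc l) := rfl

theorem size_enc_append {α : Type} [Encoded α] (l l' : List α) :
    (enc (l ++ l')).size + 1 = (enc l).size + (enc l').size := by
  induction l with
  | nil => change _ = 1 + _; simp [add_comm]
  | cons a l ih =>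
    simp only [List.cons_append, enc_cons, Data.size]
    omega

theorem size_enc_sigma {α : Type} {β : α → Type} [Encoded α] [∀ a, Encoded (β a)] (a : α)
    (b : β a) : (enc (⟨a, b⟩ : Σ a, β a)).size = (enc a).size + (enc b).size + 1 := rfl

theorem size_enc_prod {α β : Type} [Encoded α] [Encoded β] (a : α) (b : β) :
    (enc (a, b)).size = (enc a).size + (enc b).size + 1 := rfl

namespace PolyTime

section Nondependent

variable {α β γ : Type} [Encoded α] [Encoded β] [Encoded γ]

theorem id : PolyTime fun a : α => a := Transforms.refl _

theorem const (b : β) : PolyTime fun _ : α => b := Transforms.const _ _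

theorem cond {b : α → Bool} {f g : α → β} (hb : PolyTime b) (hf : PolyTime f) (hg : PolyTime g) :
    PolyTime fun a => bif b a then f a else g a := by
  have := Transforms.ite hb hf hg
  unfold PolyTime
  convert this using 2 with a
  cases h : b a <;> simp [h]

end Nondependent

variable {α : Type} {β γ σ : α → Type} [Encoded α] [∀ a, Encoded (β a)] [∀ a, Encoded (γ a)]
  [∀ a, Encoded (σ a)]

theorem comp {κ : Type} [Encoded κ] {f : ∀ a, β a} {g : κ → α} (hf : PolyTime f)
    (hg : PolyTime g) : PolyTime fun a => f (g a) :=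
  hg.trans (hf.comap g)

theorem pair {f : ∀ a, β a} {g : ∀ a, γ a} (hf : PolyTime f) (hg : PolyTime g) :
    PolyTime fun a => (f a, g a) :=
  Transforms.pair hf hg

theorem fst {f : ∀ a, β a × γ a} (hf : PolyTime f) : PolyTime fun a => (f a).1 := Transforms.hd hf

theorem snd {f : ∀ a, β a × γ a} (hf : PolyTime f) : PolyTime fun a => (f a).2 := Transforms.tl hf

theorem sigma_fst : PolyTime fun p : Σ a, β a => p.1 := (Transforms.refl _).hd

theorem sigma_snd : PolyTime fun p : Σ a, β a => p.2 := (Transforms.refl _).tl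

/-- Vertex types depend on the instance, so a sigma type serves as a context of variables, and
quantifying over a vertex extends the context. -/
theorem weaken {f : ∀ a, γ a} (hf : PolyTime f) : PolyTime fun p : Σ a, β a => f p.1 :=
  hf.comp sigma_fst

theorem cons {f : ∀ a, β a} {l : ∀ a, List (β a)} (hf : PolyTime f) (hl : PolyTime l) :
    PolyTime fun a => f a :: l a :=
  Transforms.pair hf hl

theorem tail {l : ∀ a, List (β a)} (hl : PolyTime l) : PolyTime fun a => (l a).tail := by
  have := Transforms.tl hl
  unfold PolyTime
  convert this using 2 with a
  cases h : l a <;> simp only [h] <;> rfl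

theorem empty : PolyTime fun a => ([] : List (β a)) := Transforms.nil _

theorem exists_size_le {f : ∀ a, β a} (hf : PolyTime f) :
    ∃ p : Polynomial ℕ, ∀ a, (enc (f a)).size ≤ p.eval (enc a).size :=
  let ⟨_, p, h⟩ := hf
  ⟨p, fun a => let ⟨_, ht, hr⟩ := h a; hr.size_le.trans ht⟩

/-- The one place where `Code.loop` is used. Iterating a polynomial-time step can blow up the
accumulator, so `hq` bounds it after every prefix of the list. -/
theorem foldl {l : ∀ a, List (β a)} {init : ∀ a, σ a} {step : ∀ a, σ a → β a → σ a} (hl : PolyTime l)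
    (hi : PolyTime init) (hs : PolyTime fun q : Σ a, σ a × β a => step q.1 q.2.1 q.2.2)
    (q : Polynomial ℕ)
    (hq : ∀ x l₁ l₂, l x = l₁ ++ l₂ →
      (enc (l₁.foldl (step x) (init x))).size ≤ q.eval (enc x).size) :
    PolyTime fun x => (l x).foldl (step x) (init x) := by
  have body : Transforms
      (fun r : Σ a, β a × (List (β a) × σ a) => Data.cons (enc r.1) (enc (r.2.1 :: r.2.2.1, r.2.2.2)))
      (fun r => Data.cons (enc r.1) (enc (r.2.2.1, step r.1 r.2.2.2 r.2.1))) := by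
    have h0 := Transforms.refl
      (fun r : Σ a, β a × (List (β a) × σ a) => Data.cons (enc r.1) (enc (r.2.1 :: r.2.2.1, r.2.2.2)))
    exact h0.hd.pair (h0.tl.hd.tl.pair ((h0.hd.pair (h0.tl.tl.pair h0.tl.hd.hd)).trans
      (hs.comap fun r : Σ a, β a × (List (β a) × σ a) => ⟨r.1, (r.2.2.2, r.2.1)⟩)))
  -- The unread list is itself the loop condition, as only the empty list is encoded by `nil`.
  have test : Transforms (fun r : Σ a, List (β a) × σ a => enc r) (fun r => enc r.2.1) :=
    (Transforms.refl _).tl.hd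
  have start : Transforms (fun x : α => enc x) (fun x => enc (⟨x, (l x, init x)⟩ : Σ a, List (β a) × σ a)) :=
    (Transforms.refl _).pair (hl.pair hi)
  have final : Transforms (fun r : Σ a, List (β a) × σ a => enc r) (fun r => enc r.2.2) :=
    (Transforms.refl _).tl.tl
  refine start.trans (Transforms.trans (E := fun x => enc (⟨x, ([],
    (l x).foldl (step x) (init x))⟩ : Σ a, List (β a) × σ a)) ?_ (final.comap _))
  obtain ⟨cb, pb, hb⟩ := body
  obtain ⟨ct, pt, ht⟩ := test
  obtain ⟨pl, hpl⟩ := hl.exists_size_le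
  -- `M` bounds the size of a configuration (input, unread list, accumulator); the 2 counts its two
  -- pairing nodes.
  let M : Polynomial ℕ := Polynomial.X + pl + q + 2
  refine ⟨Code.loop ct cb, (pl + 1) * (M + pt.comp M + pb.comp M), fun x => ?_⟩
  have hM : M.eval (enc x).size = (enc x).size + pl.eval (enc x).size + q.eval (enc x).size + 2 := by
    simp [M]
  have key : ∀ l₂ l₁, l x = l₁ ++ l₂ → ∃ t ≤ (l₂.length + 1) * (M.eval (enc x).size +
      pt.eval (M.eval (enc x).size) + pb.eval (M.eval (enc x).size)),
      Code.Run (Code.loop ct cb) (enc (⟨x, (l₂, l₁.foldl (step x) (init x))⟩ : Σ a, List (β a) × σ a))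
        (enc (⟨x, ([], (l x).foldl (step x) (init x))⟩ : Σ a, List (β a) × σ a)) t := by
    intro l₂
    induction l₂ with
    | nil =>
      intro l₁ h
      obtain ⟨t, h1, h2⟩ := ht ⟨x, ([], l₁.foldl (step x) (init x))⟩
      have hsz : (enc (⟨x, ([], l₁.foldl (step x) (init x))⟩ : Σ a, List (β a) × σ a)).size
          ≤ M.eval (enc x).size := by
        have h3 := hq x l₁ [] h
        rw [hM]
        rw [size_enc_sigma, size_enc_prod]
        have h5 : (enc ([] : List (β x))).size = 1 := rfl
        have : 1 ≤ pl.eval (enc x).size := by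
          refine le_trans ?_ (hpl x)
          cases l x <;> simp [enc, Data.ofList, Data.size]
        omega
      have h4 := h1.trans (pt.eval_mono_nat hsz)
      rw [List.append_nil] at h
      refine ⟨_, ?_, by rw [h]; exact Code.Run.loop_done h2⟩
      simp only [List.length_nil, zero_add, one_mul]
      omega
    | cons b l₂ ih =>
      intro l₁ h
      obtain ⟨t, h1, h2⟩ := ht ⟨x, (b :: l₂, l₁.foldl (step x) (init x))⟩
      obtain ⟨t', h1', h2'⟩ := hb ⟨x, (b, (l₂, l₁.foldl (step x) (init x)))⟩
      obtain ⟨t'', h1'', h2''⟩ := ih (l₁ ++ [b]) (by simp [h])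
      rw [List.foldl_append] at h2''
      have hsz : (enc (⟨x, (b :: l₂, l₁.foldl (step x) (init x))⟩ : Σ a, List (β a) × σ a)).size
          ≤ M.eval (enc x).size := by
        have h3 := hq x l₁ _ h
        have h5 := size_enc_append l₁ (b :: l₂)
        rw [← h] at h5
        have h6 := hpl x
        have h7 : 1 ≤ (enc l₁).size := by cases l₁ <;> simp [enc, Data.ofList, Data.size]
        rw [hM]
        rw [size_enc_sigma, size_enc_prod]
        omega
      have h4 := h1.trans (pt.eval_mono_nat hsz)
      have h5 := h1'.trans (pb.eval_mono_nat hsz)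
      refine ⟨_, ?_, Code.Run.loop_step h2 (by simp [enc_cons]) h2' h2''⟩
      rw [List.length_cons, add_mul (l₂.length + 1), one_mul]
      generalize (l₂.length + 1) * _ = N at h1'' ⊢
      omega
  obtain ⟨t, h1, h2⟩ := key (l x) [] rfl
  refine ⟨t, h1.trans ?_, h2⟩
  have h3 := (enc_length_le (l x)).trans (hpl x)
  have h4 : (enc x).size ≤ (enc (⟨x, (l x, init x)⟩ : Σ a, List (β a) × σ a)).size := by
    change _ ≤ (enc x).size + _ + 1
    omega
  simp only [Polynomial.eval_mul, Polynomial.eval_add, Polynomial.eval_comp, Polynomial.eval_one]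
  have h5 := M.eval_mono_nat h4
  have h6 := pl.eval_mono_nat h4
  have h7 := pt.eval_mono_nat h5
  have h8 := pb.eval_mono_nat h5
  gcongr
  omega

end PolyTime

instance : Encoded Unit := ⟨fun _ => Data.nil⟩
instance {n : ℕ} : Encoded (Fin n) := ⟨fun i => Data.ofNat i⟩

/-! ### Sizes of encodings -/

theorem size_enc_nil {α : Type} [Encoded α] : (enc ([] : List α)).size = 1 := rfl

theorem size_enc_bool (b : Bool) : (enc b).size ≤ 3 := by
  cases b <;> simp [enc, Data.ofBool, Data.size]

theorem size_enc_cons {α : Type} [Encoded α] (a : α) (l : List α) :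
    (enc (a :: l)).size = (enc a).size + (enc l).size + 1 := rfl

/-- Unary numbers are lists of units, so arithmetic reduces to list operations. -/
theorem enc_replicate_unit (n : ℕ) : enc (List.replicate n ()) = enc n := by
  simp [enc, Data.ofNat]

theorem size_enc_nat (n : ℕ) : (enc n).size = 2 * n + 1 := by
  rw [← enc_replicate_unit]
  induction n with
  | zero => rfl
  | succ n ih => rw [List.replicate_succ, size_enc_cons, ih]; simp [enc, Data.size]; omega

theorem size_enc_reverse {α : Type} [Encoded α] (l : List α) :
    (enc l.reverse).size = (enc l).size := by
  induction l with
  | nil => rfl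
  | cons a l ih =>
    have := size_enc_append l.reverse [a]
    rw [size_enc_cons, size_enc_nil] at this
    rw [List.reverse_cons, size_enc_cons]
    omega

theorem size_enc_left_le {α : Type} [Encoded α] {l l₁ l₂ : List α} (h : l = l₁ ++ l₂) :
    (enc l₁).size ≤ (enc l).size := by
  have h1 := size_enc_append l₁ l₂
  have h2 : 1 ≤ (enc l₂).size := by cases l₂ <;> simp [enc, Data.ofList, Data.size]
  rw [h]
  omega

theorem size_enc_drop_le {α : Type} [Encoded α] (l : List α) (n : ℕ) :
    (enc (l.drop n)).size ≤ (enc l).size := by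
  have h1 := size_enc_append (l.take n) (l.drop n)
  have h2 : 1 ≤ (enc (l.take n)).size := by
    cases l.take n <;> simp [enc, Data.ofList, Data.size]
  rw [List.take_append_drop] at h1
  omega

theorem size_enc_range (n : ℕ) : (enc (List.range n)).size = n ^ 2 + n + 1 := by
  induction n with
  | zero => rfl
  | succ n ih =>
    have := size_enc_append (List.range n) [n]
    rw [← List.range_succ, size_enc_cons, size_enc_nil, ih, size_enc_nat] at this
    nlinarith

theorem size_enc_flatMap_le {α β : Type} [Encoded α] [Encoded β] (l : List α) (f : α → List β)
    (B : ℕ) (h : ∀ a ∈ l, (enc (f a)).size ≤ B) :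
    (enc (l.flatMap f)).size ≤ l.length * B + 1 := by
  induction l with
  | nil => simp [size_enc_nil]
  | cons a l ih =>
    have h1 := size_enc_append (f a) (l.flatMap f)
    have h2 := ih fun b hb => h b (List.mem_cons_of_mem _ hb)
    have h3 := h a List.mem_cons_self
    rw [List.flatMap_cons, List.length_cons, add_mul, one_mul]
    omega

theorem size_enc_mem_le {α : Type} [Encoded α] {l : List α} {a : α} (h : a ∈ l) :
    (enc a).size ≤ (enc l).size := by
  induction l with
  | nil => simp at h
  | cons b l ih =>
    rw [size_enc_cons]
    rcases List.mem_cons.1 h with rfl | h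
    · omega
    · have := ih h
      omega

/-! ### Polynomial-time operations on lists and numbers -/

namespace PolyTime

section Nondependent

variable {α β : Type} [Encoded α] [Encoded β]

theorem and {f g : α → Bool} (hf : PolyTime f) (hg : PolyTime g) :
    PolyTime fun a => f a && g a := by
  simpa [Bool.cond_false_right] using hf.cond hg (const false)

theorem not {f : α → Bool} (hf : PolyTime f) : PolyTime fun a => !f a := by
  simpa [Bool.cond_false_left] using hf.cond (const false) (const true)

end Nondependent

variable {α : Type} {β γ : α → Type} [Encoded α] [∀ a, Encoded (β a)] [∀ a, Encoded (γ a)]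

theorem any {l : ∀ a, List (β a)} {f : ∀ a, β a → Bool} (hl : PolyTime l)
    (hf : PolyTime fun p : Σ a, β a => f p.1 p.2) : PolyTime fun a => (l a).any (f a) := by
  have key : ∀ (a : α) (l : List (β a)) (b : Bool),
      l.foldl (fun s x => s || f a x) b = (b || l.any (f a)) := by
    intro a l
    induction l with
    | nil => simp
    | cons x l ih => intro b; simp [ih, Bool.or_assoc]
  have := foldl (init := fun _ : α => false) (step := fun a s x => bif s then true else f a x) hl
    (const false) (sigma_snd.fst.cond (const true)
      (hf.comp (g := fun q : Σ a, Bool × β a => (⟨q.1, q.2.2⟩ : Σ a, β a))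
        (Transforms.pair sigma_fst sigma_snd.snd))) 3
    (fun _ _ _ _ => (size_enc_bool _).trans (by simp))
  simpa [Bool.cond_true_left, key] using this

theorem reverse {l : ∀ a, List (β a)} (hl : PolyTime l) : PolyTime fun a => (l a).reverse := by
  obtain ⟨p, hp⟩ := hl.exists_size_le
  have := foldl (init := fun a : α => ([] : List (β a))) (step := fun _ s x => x :: s) hl empty
    (cons (β := fun q : Σ a, List (β a) × β a => β q.1) sigma_snd.snd sigma_snd.fst) p
    (fun a l₁ l₂ h => by
      rw [List.foldl_flip_cons_eq_append', List.append_nil, size_enc_reverse]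
      exact (size_enc_left_le h).trans (hp a))
  simpa [List.foldl_flip_cons_eq_append'] using this

theorem append {l l' : ∀ a, List (β a)} (hl : PolyTime l) (hl' : PolyTime l') :
    PolyTime fun a => l a ++ l' a := by
  obtain ⟨p, hp⟩ := hl.exists_size_le
  obtain ⟨p', hp'⟩ := hl'.exists_size_le
  have := foldl (init := l') (step := fun _ s x => x :: s) hl.reverse hl'
    (cons (β := fun q : Σ a, List (β a) × β a => β q.1) sigma_snd.snd sigma_snd.fst) (p + p')
    (fun a l₁ l₂ h => by
      have h1 := size_enc_left_le h
      have h2 := size_enc_append l₁.reverse (l' a)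
      have h3 := hp a
      have h4 := hp' a
      rw [size_enc_reverse] at h1 h2
      rw [List.foldl_flip_cons_eq_append', Polynomial.eval_add]
      omega)
  simpa [List.foldl_flip_cons_eq_append'] using this

theorem flatMap {l : ∀ a, List (β a)} {f : ∀ a, β a → List (γ a)} (hl : PolyTime l)
    (hf : PolyTime fun p : Σ a, β a => f p.1 p.2) : PolyTime fun a => (l a).flatMap (f a) := by
  have key : ∀ (a : α) (l : List (β a)) (s : List (γ a)),
      l.foldl (fun s x => s ++ f a x) s = s ++ l.flatMap (f a) := by
    intro a l
    induction l with
    | nil => simp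
    | cons x l ih => intro s; simp [ih]
  obtain ⟨p, hp⟩ := hl.exists_size_le
  obtain ⟨q, hq⟩ := hf.exists_size_le
  have := foldl (init := fun a : α => ([] : List (γ a))) (step := fun a s x => s ++ f a x) hl empty
    (append (β := fun q : Σ a, List (γ a) × β a => γ q.1) sigma_snd.fst
      (hf.comp (g := fun q : Σ a, List (γ a) × β a => (⟨q.1, q.2.2⟩ : Σ a, β a))
        (Transforms.pair sigma_fst sigma_snd.snd)))
    (p * q.comp (Polynomial.X + p + 1) + 1) (fun a l₁ l₂ h => by
      rw [key, List.nil_append]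
      have h1 := (enc_length_le l₁).trans ((size_enc_left_le h).trans (hp a))
      refine (size_enc_flatMap_le l₁ (f a) (q.eval ((enc a).size + p.eval (enc a).size + 1))
        fun b hb => ?_).trans ?_
      · refine (hq ⟨a, b⟩).trans (q.eval_mono_nat ?_)
        have := (size_enc_mem_le hb).trans ((size_enc_left_le h).trans (hp a))
        rw [size_enc_sigma]
        omega
      · simp only [Polynomial.eval_add, Polynomial.eval_mul, Polynomial.eval_comp,
          Polynomial.eval_X, Polynomial.eval_one]
        gcongr)
  simpa [key] using this

theorem map {l : ∀ a, List (β a)} {f : ∀ a, β a → γ a} (hl : PolyTime l)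
    (hf : PolyTime fun p : Σ a, β a => f p.1 p.2) : PolyTime fun a => (l a).map (f a) := by
  have := flatMap (f := fun a b => [f a b]) hl (cons (β := fun p : Σ a, β a => γ p.1) hf empty)
  simpa only [← List.map_eq_flatMap] using this

theorem filter {l : ∀ a, List (β a)} {f : ∀ a, β a → Bool} (hl : PolyTime l)
    (hf : PolyTime fun p : Σ a, β a => f p.1 p.2) : PolyTime fun a => (l a).filter (f a) := by
  have h : PolyTime fun p : Σ a, β a => if f p.1 p.2 then [p.2] else [] := by
    have h := Transforms.ite hf
      (cons (β := fun p : Σ a, β a => β p.1) sigma_snd empty) (Transforms.nil _)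
    unfold PolyTime
    convert h using 2 with p
    by_cases hp : f p.1 p.2 <;> simp only [hp, if_true, Bool.false_eq_true, if_false] <;> rfl
  have := flatMap (f := fun a b => if f a b then [b] else []) hl h
  have key : ∀ (a : α) (l : List (β a)),
      (l.flatMap fun b => if f a b then [b] else []) = l.filter (f a) := by
    intro a l
    induction l with
    | nil => rfl
    | cons x l ih => cases h : f a x <;> simp [h, ih]
  simpa [key] using this

theorem length {l : ∀ a, List (β a)} (hl : PolyTime l) : PolyTime fun a => (l a).length := by
  have := map (f := fun _ _ => ()) hl (const ())
  unfold PolyTime at this ⊢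
  simpa only [List.map_const', enc_replicate_unit] using this

section Numbers

variable {β : Type} [Encoded β]

theorem units {n : α → ℕ} (hn : PolyTime n) : PolyTime fun a => List.replicate (n a) () := by
  unfold PolyTime at hn ⊢
  simpa only [enc_replicate_unit] using hn

theorem succ {n : α → ℕ} (hn : PolyTime n) : PolyTime fun a => n a + 1 := by
  simpa using ((const ()).cons hn.units).length

theorem drop {l : α → List β} {n : α → ℕ} (hl : PolyTime l) (hn : PolyTime n) :
    PolyTime fun a => (l a).drop (n a) := by
  have key : ∀ (l : List β) (u : List Unit), u.foldl (fun s _ => s.tail) l = l.drop u.length := by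
    intro l u
    induction u generalizing l with
    | nil => rfl
    | cons x u ih => simp [ih]
  obtain ⟨p, hp⟩ := hl.exists_size_le
  have := foldl (step := fun _ s _ => s.tail) hn.units hl sigma_snd.fst.tail p
    (fun a l₁ l₂ h => by rw [key]; exact (size_enc_drop_le _ _).trans (hp a))
  simpa [key] using this

/-- The default has to be encoded by `nil` because that is what `Data.hd` returns on the empty list.
-/
theorem headD {l : α → List β} {d : β} (hl : PolyTime l) (hd : enc d = Data.nil) :
    PolyTime fun a => (l a).headD d := by
  have := Transforms.hd hl
  unfold PolyTime
  convert this using 2 with a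
  cases h : l a <;> simp only [h]
  · exact hd
  · rfl

theorem getD {l : α → List β} {n : α → ℕ} {d : β} (hl : PolyTime l) (hn : PolyTime n)
    (hd : enc d = Data.nil) : PolyTime fun a => (l a).getD (n a) d := by
  have := (hl.drop hn).headD hd
  simpa [List.headD_eq_head?_getD, List.getD_eq_getElem?_getD] using this

theorem isEmpty {l : α → List β} (hl : PolyTime l) : PolyTime fun a => (l a).isEmpty := by
  have := (any (f := fun _ _ => true) hl (const true)).not
  convert this using 2 with a
  cases l a <;> simp

theorem le {m n : α → ℕ} (hm : PolyTime m) (hn : PolyTime n) :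
    PolyTime fun a => decide (m a ≤ n a) := by
  have := (hm.units.drop hn).isEmpty
  simpa [List.isEmpty_iff, Bool.eq_iff_iff, Nat.sub_eq_zero_iff_le] using this

theorem eq {m n : α → ℕ} (hm : PolyTime m) (hn : PolyTime n) :
    PolyTime fun a => decide (m a = n a) := by
  simpa [le_antisymm_iff] using (hm.le hn).and (hn.le hm)

theorem range {n : α → ℕ} (hn : PolyTime n) : PolyTime fun a => List.range (n a) := by
  have key : ∀ (u : List Unit), u.foldl (fun s _ => 0 :: s.map fun i => i + 1) [] =
      List.range u.length := by
    intro u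
    induction u using List.reverseRecOn with
    | nil => rfl
    | append_singleton u x ih => simp [ih, List.range_succ_eq_map]
  obtain ⟨p, hp⟩ := hn.exists_size_le
  have := foldl (step := fun _ s _ => 0 :: s.map fun i => i + 1) hn.units empty
    ((const 0).cons (sigma_snd.fst.map (f := fun _ i => i + 1) sigma_snd.succ)) (p ^ 2 + p + 1) (fun a l₁ l₂ h => by
      have h1 := congrArg List.length h
      have h2 := hp a
      rw [List.length_replicate, List.length_append] at h1
      rw [size_enc_nat] at h2
      rw [key, size_enc_range]
      simp only [Polynomial.eval_add, Polynomial.eval_pow, Polynomial.eval_one]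
      gcongr <;> omega)
  simpa [key] using this

end Numbers

end PolyTime

/-! ### The structure of `(P₁ + P₃)`-free graphs -/

namespace SimpleGraph

variable {V W : Type}

/-- An edge may collapse to a vertex or stretch to a walk, which covers both contracting cliques and
replacing added edges. -/
theorem Reachable.map_of_adj {G : SimpleGraph V} {H : SimpleGraph W} (φ : V → W)
    (h : ∀ u v, G.Adj u v → H.Reachable (φ u) (φ v)) {a b : V} (hab : G.Reachable a b) :
    H.Reachable (φ a) (φ b) := by
  obtain ⟨w⟩ := hab
  induction w with
  | nil => exact .refl _
  | cons hadj _ ih => exact (h _ _ hadj).trans ih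

theorem Reachable.exists_walk_of_induce {G : SimpleGraph V} {S : Set V} {a b : S}
    (h : (G.induce S).Reachable a b) : ∃ w : G.Walk a b, ∀ x ∈ w.support, x ∈ S := by
  obtain ⟨w⟩ := h
  refine ⟨w.map (Embedding.induce S).toHom, fun x hx => ?_⟩
  obtain ⟨y, _, rfl⟩ := List.mem_map.1 ((Walk.support_map _ w).subst (motive := (x ∈ ·)) hx)
  exact y.2

theorem connected_induce_of_reachable {G : SimpleGraph V} {S : Set V} {r : V} (hr : r ∈ S)
    (h : ∀ v (hv : v ∈ S), (G.induce S).Reachable ⟨r, hr⟩ ⟨v, hv⟩) : (G.induce S).Connected :=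
  (connected_iff_exists_forall_reachable _).2 ⟨⟨r, hr⟩, fun v => h v.1 v.2⟩

/-- Every induced `P₃` is a dominating set. -/
def InducedP3Dominates (G : SimpleGraph V) : Prop :=
  ∀ x a b c, G.Adj a b → G.Adj b c → a ≠ c → ¬ G.Adj a c → G.Adj x a ∨ G.Adj x b ∨ G.Adj x c

/-- `v` belongs to an independent set of size three. -/
def InTriad (G : SimpleGraph V) (v : V) : Prop :=
  ∃ a b, v ≠ a ∧ v ≠ b ∧ a ≠ b ∧ ¬ G.Adj v a ∧ ¬ G.Adj v b ∧ ¬ G.Adj a b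

/-- Some vertex is adjacent to neither of `u` and `v` (it may be one of them). -/
def CoClose (G : SimpleGraph V) (u v : V) : Prop := ∃ w, ¬ G.Adj u w ∧ ¬ G.Adj v w

variable {G : SimpleGraph V}

theorem CoClose.refl (v : V) : G.CoClose v v := ⟨v, G.irrefl, G.irrefl⟩

theorem CoClose.symm {u v : V} (h : G.CoClose u v) : G.CoClose v u :=
  let ⟨w, h1, h2⟩ := h
  ⟨w, h2, h1⟩

theorem CoClose.of_not_adj {u v : V} (h : ¬ G.Adj u v) : G.CoClose u v :=
  ⟨v, h, G.irrefl⟩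

/-- If `u`, `a`, `b` are independent and `v` misses `u`, then `v` sees `a` and `b`, since it is in
no triad; so `a`, `v`, `b` is an induced `P₃` that misses `u`. -/
theorem InTriad.adj_of_not (hG : G.InducedP3Dominates) {u v : V} (hu : G.InTriad u)
    (hv : ¬ G.InTriad v) : G.Adj u v := by
  obtain ⟨a, b, hua, hub, hab, nua, nub, nab⟩ := hu
  by_contra huv
  have h1 := hG u a v b
  unfold InTriad at hv
  push Not at hv
  have h2 := hv u a
  have h3 := hv u b
  have h4 := hv a b
  by_cases e1 : v = u
  · grind
  by_cases e2 : v = a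
  · grind [SimpleGraph.adj_comm]
  by_cases e3 : v = b
  · grind [SimpleGraph.adj_comm]
  grind [SimpleGraph.adj_comm, SimpleGraph.irrefl]

/-- Distinct pieces are completely joined. As `x` sees every non-neighbour of `s`, it sees the whole
triad of `s`; a nonadjacent `z` then leads to an induced `P₃` that is not dominating. -/
theorem adj_of_not_coClose (hG : G.InducedP3Dominates) {x s z : V} (hs : G.InTriad s)
    (hx : ¬ G.CoClose x s) (hz : G.CoClose z s) : G.Adj x z := by
  obtain ⟨w, hzw, hsw⟩ := hz
  obtain ⟨b, c, hsb, hsc, hbc, nsb, nsc, nbc⟩ := hs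
  unfold CoClose at hx
  push Not at hx
  by_contra hxz
  have h1 := hx b
  have h2 := hx c
  have h3 := hx w
  have h4 := hx z
  have h5 := hx s
  have e1 := hG z b x c
  have e2 := hG w s z b
  have e3 := hG w s z c
  have e4 := hG w b z c
  have e5 := hG s b z c
  have e6 := hG c s z b
  have e7 := hG b s z c
  have e8 := hG s b w c
  grind [SimpleGraph.adj_comm, SimpleGraph.irrefl]

/-- Were `x` not co-close to `y`, the common non-neighbour `w` of `x` and `s` would see `x` if it is
co-close to `y`, and `s` otherwise. -/
theorem CoClose.trans (hG : G.InducedP3Dominates) {x s y : V} (hy : G.InTriad y)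
    (h : G.CoClose x s) (h' : G.CoClose s y) : G.CoClose x y := by
  by_contra hxy
  obtain ⟨w, hxw, hsw⟩ := h
  have hw : ¬ G.CoClose w y := fun hw => hxw (adj_of_not_coClose hG hy hxy hw)
  exact hsw (adj_of_not_coClose hG hy hw h').symm

theorem CoClose.inTriad (hG : G.InducedP3Dominates) {x s : V} (hs : G.InTriad s)
    (h : G.CoClose x s) : G.InTriad x := by
  by_contra hx
  obtain ⟨w, hxw, hsw⟩ := h
  by_cases hw : G.InTriad w
  · exact hxw (hw.adj_of_not hG hx).symm
  · exact hsw (hs.adj_of_not hG hw)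

/-- A piece with triads contains no induced `P₃`, so it is a disjoint union of cliques. -/
theorem adj_trans_of_coClose (hG : G.InducedP3Dominates) {a b c : V} (ha : G.InTriad a)
    (hba : G.CoClose b a) (hab : G.Adj a b) (hbc : G.Adj b c) (hac : a ≠ c) : G.Adj a c := by
  by_contra nac
  obtain ⟨w, hbw, haw⟩ := hba
  obtain ⟨p, q, hap, haq, hpq, nap, naq, npq⟩ := ha
  -- If `a` and `c` are nonadjacent, they extend to an independent triple: were both `p` and `q`
  -- seen by `c`, the path `p`, `c`, `q` would miss `a`.
  have hp : ∃ p, a ≠ p ∧ c ≠ p ∧ ¬ G.Adj a p ∧ ¬ G.Adj c p := by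
    have := hG a p c q
    by_cases h1 : c = p
    · exact ⟨q, haq, by grind, naq, by grind⟩
    by_cases h2 : c = q
    · exact ⟨p, hap, by grind, nap, by grind [SimpleGraph.adj_comm]⟩
    by_cases h3 : G.Adj c p
    · exact ⟨q, haq, h2, naq, by grind [SimpleGraph.adj_comm]⟩
    · exact ⟨p, hap, h1, nap, h3⟩
  obtain ⟨p, hap, hcp, nap, ncp⟩ := hp
  have e1 := hG p a b c
  -- Here `w` must see both `c` and `p`, and then `c`, `w`, `p` is an induced `P₃` that misses `a`.
  have e2 := hG w a b c
  have e3 := hG w a b p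
  have e4 := hG w c b p
  have e5 := hG a c w p
  grind [SimpleGraph.adj_comm, SimpleGraph.irrefl]

end SimpleGraph

/-! ### From connected subgraphs to paths -/

namespace SimpleGraph

variable {V ι : Type} {G : SimpleGraph V}

/-- An induced `P₃` inside `A` dominates `A`, so every vertex is linked to its middle vertex `b`. -/
theorem InducedP3Dominates.connected_induce (hG : G.InducedP3Dominates) {A : Set V}
    (hA : A.Nonempty)
    (h : (∃ u ∈ A, ∃ v ∈ A, u ≠ v ∧ ¬ G.Adj u v) →
      ∃ a ∈ A, ∃ b ∈ A, ∃ c ∈ A, G.Adj a b ∧ G.Adj b c ∧ a ≠ c ∧ ¬ G.Adj a c) :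
    (G.induce A).Connected := by
  by_cases h' : ∃ u ∈ A, ∃ v ∈ A, u ≠ v ∧ ¬ G.Adj u v
  · obtain ⟨a, ha, b, hb, c, hc, hab, hbc, hac, nac⟩ := h h'
    have rb : ∀ {u} (hu : u ∈ A), G.Adj b u → (G.induce A).Reachable ⟨b, hb⟩ ⟨u, hu⟩ :=
      fun _ h => Adj.reachable (G := G.induce A) h
    have step : ∀ {u v} (hu : u ∈ A) (hv : v ∈ A), G.Adj v u →
        (G.induce A).Reachable ⟨b, hb⟩ ⟨u, hu⟩ → (G.induce A).Reachable ⟨b, hb⟩ ⟨v, hv⟩ :=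
      fun _ _ h h' => h'.trans (Adj.reachable (G := G.induce A) h.symm)
    refine connected_induce_of_reachable hb fun v hv => ?_
    rcases hG v a b c hab hbc hac nac with h1 | h1 | h1
    · exact step ha hv h1 (rb ha hab.symm)
    · exact rb hv h1.symm
    · exact step hc hv h1 (rb hc hbc)
  · obtain ⟨r, hr⟩ := hA
    push Not at h'
    refine connected_induce_of_reachable hr fun v hv => ?_
    by_cases e : r = v
    · subst e
      rfl
    · exact Adj.reachable (G := G.induce A) (h' r hr v hv e)

theorem eq_or_adj_of_reachable_induce {S : Set V}
    (h : ∀ a ∈ S, ∀ b ∈ S, ∀ c ∈ S, G.Adj a b → G.Adj b c → a ≠ c → G.Adj a c) {u v : S}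
    (huv : (G.induce S).Reachable u v) : u = v ∨ G.Adj u v := by
  obtain ⟨w⟩ := huv
  induction w with
  | nil => exact .inl rfl
  | @cons u b v hadj _ ih =>
    rcases ih with rfl | ih
    · exact .inr hadj
    · by_cases e : u = v
      · exact .inl e
      · exact .inr (h _ u.2 _ b.2 _ v.2 hadj ih fun e' => e (Subtype.ext e'))

/-- `A` induces a disjoint union of at least two complete graphs. -/
def IsSplit (G : SimpleGraph V) (A : Finset V) : Prop :=
  (∃ u ∈ A, ∃ v ∈ A, u ≠ v ∧ ¬ G.Adj u v) ∧
    ∀ a ∈ A, ∀ b ∈ A, ∀ c ∈ A, G.Adj a b → G.Adj b c → a ≠ c → G.Adj a c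

theorem InducedP3Dominates.connected_of_not_isSplit (hG : G.InducedP3Dominates) {A : Finset V}
    (hA : A.Nonempty) (h : ¬ G.IsSplit A) : (G.induce (A : Set V)).Connected := by
  refine hG.connected_induce hA fun h' => ?_
  unfold IsSplit at h
  push Not at h
  simpa using h (by simpa using h')

/-- The canonical choice of vertices `s` and `t` in different components of a split set. -/
def IsSplitPair [LinearOrder V] (G : SimpleGraph V) (A : Finset V) (s t : V) : Prop :=
  G.IsSplit A ∧ s ∈ A ∧ t ∈ A ∧ s ≠ t ∧ ¬ G.Adj s t ∧ (∀ u ∈ A, s ≤ u) ∧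
    ∀ u ∈ A, u ≠ s → ¬ G.Adj s u → t ≤ u

variable [LinearOrder V] {Z : ι → Finset V}

theorem IsSplit.exists_isSplitPair {A : Finset V} (h : G.IsSplit A) :
    ∃ s t, G.IsSplitPair A s t := by
  classical
  obtain ⟨u, hu, v, hv, huv, nuv⟩ := h.1
  obtain ⟨s, hs, hmin⟩ := A.exists_min_image _root_.id ⟨u, hu⟩
  -- If `s` saw all the rest of `A`, transitivity through `s` would make `u` and `v` adjacent.
  have hne : (A.filter fun x => x ≠ s ∧ ¬ G.Adj s x).Nonempty := by
    by_contra hcon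
    rw [Finset.not_nonempty_iff_eq_empty, Finset.filter_eq_empty_iff] at hcon
    have h1 := hcon hu
    have h2 := hcon hv
    have h3 := h.2 u hu s hs v hv
    grind [SimpleGraph.adj_comm]
  obtain ⟨t, ht, htmin⟩ := Finset.exists_min_image _ _root_.id hne
  rw [Finset.mem_filter] at ht
  refine ⟨s, t, h, hs, ht.1, ht.2.1.symm, ht.2.2, hmin, fun x hx hxs nsx => ?_⟩
  exact htmin x (Finset.mem_filter.2 ⟨hx, hxs, nsx⟩)

namespace IsSplitPair

variable {A : Finset V} {s t s' t' z : V}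

theorem unique (h : G.IsSplitPair A s t) (h' : G.IsSplitPair A s' t') : s = s' ∧ t = t' := by
  obtain ⟨-, hs, ht, hst, nst, h1, h2⟩ := h
  obtain ⟨-, hs', ht', hst', nst', h1', h2'⟩ := h'
  have e : s = s' := le_antisymm (h1 _ hs') (h1' _ hs)
  subst e
  exact ⟨rfl, le_antisymm (h2 _ ht' hst'.symm nst') (h2' _ ht hst.symm nst)⟩

/-- A vertex of `A` cannot see both `s` and `t`, since these lie in different cliques; if `s` lies
in a triad, all of `A` lies in its piece. -/
theorem coClose (h : G.IsSplitPair A s t) (hz : z ∈ A) : G.CoClose z s := by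
  obtain ⟨⟨-, h0⟩, hsA, htA, hst, nst, -, -⟩ := h
  by_cases h1 : G.Adj z t
  · refine .of_not_adj fun h2 => nst (h0 s hsA z hz t htA h2.symm h1 hst)
  · exact ⟨t, h1, nst⟩

/-- A third clique of `A` would put `s` in a triad, so those of `s` and `t` are the only ones. -/
theorem eq_or_adj (h : G.IsSplitPair A s t) (hs : ¬ G.InTriad s) :
    (z = s ∨ G.Adj z s) ∨ (z = t ∨ G.Adj z t) := by
  by_contra hcon
  push Not at hcon
  obtain ⟨⟨h1, h2⟩, h3, h4⟩ := hcon
  exact hs ⟨t, z, h.2.2.2.1, Ne.symm h1, Ne.symm h3, h.2.2.2.2.1, fun h' => h2 h'.symm,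
    fun h' => h4 h'.symm⟩

/-- A triad vertex in `A` would see both `s` and `t`, joining their cliques. -/
theorem not_inTriad (h : G.IsSplitPair A s t) (hG : G.InducedP3Dominates) (hs : ¬ G.InTriad s)
    (hz : z ∈ A) : ¬ G.InTriad z := by
  intro hzT
  have ht : ¬ G.InTriad t := fun ht => h.2.2.2.2.1 (ht.adj_of_not hG hs).symm
  exact h.2.2.2.2.1 (h.1.2 s h.2.1 z hz t h.2.2.1 (hzT.adj_of_not hG hs).symm
    (hzT.adj_of_not hG ht) h.2.2.2.1)

end IsSplitPair

/-- `v` belongs to one of the terminal sets. -/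
def IsTerminal (Z : ι → Finset V) (v : V) : Prop := ∃ i, v ∈ Z i

/-- `v` is the second vertex of the canonical pair of a terminal set. -/
def IsTarget (G : SimpleGraph V) (Z : ι → Finset V) (v : V) : Prop :=
  ∃ i s, G.IsSplitPair (Z i) s v

/-- The terminal pairs: the canonical pairs of the split terminal sets, and the trivial pairs of
the remaining terminals. -/
def IsTerminalPair (G : SimpleGraph V) (Z : ι → Finset V) (s t : V) : Prop :=
  (∃ i, G.IsSplitPair (Z i) s t) ∨
    s = t ∧ ∃ i, s ∈ Z i ∧ ∀ w, ¬ G.IsSplitPair (Z i) s w ∧ ¬ G.IsSplitPair (Z i) w s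

/-- `v` is no terminal, and adjacent to the component of `u` in its split terminal set. -/
def AdjComponent (G : SimpleGraph V) (Z : ι → Finset V) (u v : V) : Prop :=
  ∃ i, G.IsSplit (Z i) ∧ u ∈ Z i ∧ ¬ IsTerminal Z v ∧ ∃ w ∈ Z i, G.Adj u w ∧ G.Adj w v

/-- The graph in which linking the terminal pairs by paths amounts to linking the terminal sets
`Z i` by connected subgraphs in `G`. -/
def pathReduction (G : SimpleGraph V) (Z : ι → Finset V) : SimpleGraph V where
  Adj u v := u ≠ v ∧
    ((G.InTriad u ∧ G.InTriad v ∧ (G.CoClose u v → (G.IsTarget Z u ↔ G.IsTarget Z v))) ∨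
      (¬ (G.InTriad u ∧ G.InTriad v) ∧ (G.Adj u v ∨ G.AdjComponent Z u v ∨ G.AdjComponent Z v u)))
  symm := ⟨by
    rintro u v ⟨h1, ⟨hu, hv, h2⟩ | ⟨h2, h3⟩⟩
    · exact ⟨h1.symm, .inl ⟨hv, hu, fun h => (h2 h.symm).symm⟩⟩
    · exact ⟨h1.symm, .inr ⟨fun h => h2 h.symm, by rw [G.adj_comm]; tauto⟩⟩⟩
  loopless := ⟨fun _ h => h.1 rfl⟩

theorem pathReduction_adj_of_not_coClose (hG : G.InducedP3Dominates) {s x : V} (hs : G.InTriad s)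
    (hx : ¬ G.CoClose x s) : (G.pathReduction Z).Adj s x := by
  have hadj := adj_of_not_coClose hG hs hx (.refl s)
  refine ⟨hadj.ne', ?_⟩
  by_cases hxT : G.InTriad x
  · exact .inl ⟨hs, hxT, fun h => absurd h.symm hx⟩
  · exact .inr ⟨fun h => hxT h.2, .inl hadj.symm⟩

theorem pathReduction_adj_of_adj {s x : V} (hs : ¬ G.InTriad s) (hx : G.Adj s x) :
    (G.pathReduction Z).Adj s x :=
  ⟨hx.ne, .inr ⟨fun h => hs h.1, .inl hx⟩⟩

/-- A triad vertex and a non-triad vertex are adjacent, so an independent triple is of one kind.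
Triad vertices would need three different target statuses; the others would form a triad of `G`. -/
theorem pathReduction_triad {a b c : V} (hab : a ≠ b) (hbc : b ≠ c) (hac : a ≠ c)
    (nab : ¬ (G.pathReduction Z).Adj a b) (nbc : ¬ (G.pathReduction Z).Adj b c)
    (nac : ¬ (G.pathReduction Z).Adj a c) (hG : G.InducedP3Dominates) : False := by
  have key : ∀ {u v}, u ≠ v → ¬ (G.pathReduction Z).Adj u v → ¬ G.InTriad u → ¬ G.Adj u v :=
    fun _ h hu h' => h (pathReduction_adj_of_adj hu h')
  have key' : ∀ {u v}, u ≠ v → ¬ (G.pathReduction Z).Adj u v → (G.InTriad u ↔ G.InTriad v) := by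
    refine fun {u v} huv h => ⟨fun hu => ?_, fun hv => ?_⟩
    · by_contra hv
      exact h (pathReduction_adj_of_adj hv (hu.adj_of_not hG hv).symm).symm
    · by_contra hu
      exact h (pathReduction_adj_of_adj hu (hv.adj_of_not hG hu).symm)
  by_cases ha : G.InTriad a
  · have hb := (key' hab nab).1 ha
    have hc := (key' hac nac).1 ha
    have key'' : ∀ {u v}, u ≠ v → ¬ (G.pathReduction Z).Adj u v → G.InTriad u → G.InTriad v →
        ¬ (G.IsTarget Z u ↔ G.IsTarget Z v) :=
      fun huv h hu hv h' => h ⟨huv, .inl ⟨hu, hv, fun _ => h'⟩⟩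
    have h1 := key'' hab nab ha hb
    have h2 := key'' hbc nbc hb hc
    have h3 := key'' hac nac ha hc
    tauto
  · have hb : ¬ G.InTriad b := fun hb => ha ((key' hab nab).2 hb)
    exact ha ⟨b, c, hab, hac, hbc, key hab nab ha, key hac nac ha, key hbc nbc hb⟩

/-! ### Correctness for a single split terminal set -/

section Correctness

variable (hG : G.InducedP3Dominates) {i : ι} {s t : V}
include hG

theorem exists_pathReduction_walk {S : Set V} (hst : G.IsSplitPair (Z i) s t)
    (hS : (G.induce S).Connected) (hZS : (Z i : Set V) ⊆ S)
    (hdisj : ∀ v ∈ S, v ∉ Z i → ¬ IsTerminal Z v) :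
    ∃ w : (G.pathReduction Z).Walk s t, ∀ x ∈ w.support, x = s ∨ x = t ∨ (x ∈ S ∧ x ∉ Z i) := by
  classical
  obtain ⟨⟨-, htrans⟩, hsA, htA, hne, nst, -, -⟩ := id hst
  have viaOne : ∀ x ∈ S, x ∉ Z i → (G.pathReduction Z).Adj s x → (G.pathReduction Z).Adj t x →
      ∃ w : (G.pathReduction Z).Walk s t,
        ∀ x ∈ w.support, x = s ∨ x = t ∨ (x ∈ S ∧ x ∉ Z i) := by
    intro x hx hxZ hsx htx
    refine ⟨.cons hsx (.cons htx.symm .nil), fun y hy => ?_⟩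
    simp only [Walk.support_cons, Walk.support_nil, List.mem_cons, List.not_mem_nil,
      or_false] at hy
    rcases hy with rfl | rfl | rfl
    · exact .inl rfl
    · exact .inr (.inr ⟨hx, hxZ⟩)
    · exact .inr (.inl rfl)
  by_cases hs : G.InTriad s
  · have htT := (hst.coClose htA).inTriad hG hs
    have : ∃ x ∈ S, ¬ G.CoClose x s := by
      -- Within one piece adjacency is transitive, so connectedness of `S` would make `s` and `t`
      -- adjacent.
      by_contra! hcon
      have := eq_or_adj_of_reachable_induce (G := G) (S := S) (fun a ha b hb c hc hab hbc hac =>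
        adj_trans_of_coClose hG ((hcon a ha).inTriad hG hs)
          ((hcon b hb).trans hG ((hcon a ha).inTriad hG hs) (hcon a ha).symm) hab hbc hac)
        (hS.preconnected ⟨s, hZS hsA⟩ ⟨t, hZS htA⟩)
      rcases this with h | h
      · exact hne (congrArg Subtype.val h)
      · exact nst h
    obtain ⟨x, hx, hxs⟩ := this
    refine viaOne x hx (fun h => hxs (hst.coClose h))
      (pathReduction_adj_of_not_coClose hG hs hxs) (pathReduction_adj_of_not_coClose hG htT
        fun h => hxs (h.trans hG hs (hst.coClose htA)))
  · have hA : ∀ z ∈ Z i, ¬ G.InTriad z := fun z hz => hst.not_inTriad hG hs hz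
    by_cases hT : ∃ x ∈ S, G.InTriad x
    · obtain ⟨x, hx, hxT⟩ := hT
      exact viaOne x hx (fun h => hA x h hxT)
        (pathReduction_adj_of_adj hs (hxT.adj_of_not hG hs).symm)
        (pathReduction_adj_of_adj (hA t htA) (hxT.adj_of_not hG (hA t htA)).symm)
    push Not at hT
    -- With no triad vertex in `S`, `φ` contracts the two cliques of `Z i` to `s` and `t` and fixes
    -- the rest; the added edges keep the adjacencies of the contracted cliques.
    let U : Set V := {x | x = s ∨ x = t ∨ (x ∈ S ∧ x ∉ Z i)}
    let φ : S → U := fun z =>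
      if hz : z.1 ∈ Z i then
        if z.1 = s ∨ G.Adj z s then ⟨s, .inl rfl⟩ else ⟨t, .inr (.inl rfl)⟩
      else ⟨z, .inr (.inr ⟨z.2, hz⟩)⟩
    have hφs : φ ⟨s, hZS hsA⟩ = ⟨s, .inl rfl⟩ := by simp [φ, hsA]
    have hφt : φ ⟨t, hZS htA⟩ = ⟨t, .inr (.inl rfl)⟩ := by
      simp [φ, htA, hne.symm, G.adj_comm t s, nst]
    have hin : ∀ u v : S, G.Adj u v → u.1 ∈ Z i → v.1 ∉ Z i →
        ((G.pathReduction Z).induce U).Reachable (φ u) (φ v) := by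
      intro u v huv hu hv
      have hv' : φ v = ⟨v, .inr (.inr ⟨v.2, hv⟩)⟩ := by simp [φ, hv]
      have hadj : ∀ r ∈ Z i, (u.1 = r ∨ G.Adj u r) → (G.pathReduction Z).Adj r v := by
        rintro r hr (rfl | h)
        · exact pathReduction_adj_of_adj (hA _ hr) huv
        · refine ⟨fun e => hv (e ▸ hr), .inr ⟨fun h' => hA _ hr h'.1, .inr (.inl ?_)⟩⟩
          exact ⟨i, hst.1, hr, hdisj v v.2 hv, u, hu, h.symm, huv⟩
      rw [hv']
      by_cases h : u.1 = s ∨ G.Adj u s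
      · have hu' : φ u = ⟨s, .inl rfl⟩ := by simp [φ, hu, h]
        rw [hu']
        exact Adj.reachable (G := (G.pathReduction Z).induce U) (hadj s hsA h)
      · have hu' : φ u = ⟨t, .inr (.inl rfl)⟩ := by simp [φ, hu, h]
        rw [hu']
        exact Adj.reachable (G := (G.pathReduction Z).induce U)
          (hadj t htA ((hst.eq_or_adj hs).resolve_left h))
    have hmap := Reachable.map_of_adj (G := G.induce S) (H := (G.pathReduction Z).induce U) φ
      (fun u v huv => by
        have huv : G.Adj u v := huv
        by_cases hu : u.1 ∈ Z i <;> by_cases hv : v.1 ∈ Z i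
        · have hiff : (u.1 = s ∨ G.Adj u s) ↔ (v.1 = s ∨ G.Adj v s) := by
            have h1 := htrans u hu v hv s hsA
            have h2 := htrans v hv u hu s hsA
            grind [SimpleGraph.adj_comm]
          have : φ u = φ v := by simp [φ, hu, hv, hiff]
          rw [this]
        · exact hin u v huv hu hv
        · exact (hin v u huv.symm hv hu).symm
        · have hu' : φ u = ⟨u, .inr (.inr ⟨u.2, hu⟩)⟩ := by simp [φ, hu]
          have hv' : φ v = ⟨v, .inr (.inr ⟨v.2, hv⟩)⟩ := by simp [φ, hv]
          rw [hu', hv']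
          exact Adj.reachable (G := (G.pathReduction Z).induce U)
            (pathReduction_adj_of_adj (hT _ u.2) huv))
      (hS.preconnected ⟨s, hZS hsA⟩ ⟨t, hZS htA⟩)
    rw [hφs, hφt] at hmap
    exact hmap.exists_walk_of_induce

theorem exists_connected_of_pathReduction_walk (hZ : Pairwise fun i j => Disjoint (Z i) (Z j))
    (hst : G.IsSplitPair (Z i) s t) (w : (G.pathReduction Z).Walk s t)
    (hw : ∀ x ∈ w.support, IsTerminal Z x → x = s ∨ x = t) :
    ∃ S : Set V, (G.induce S).Connected ∧ (Z i : Set V) ⊆ S ∧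
      ∀ x ∈ S, x ∈ Z i ∨ x ∈ w.support := by
  obtain ⟨-, hsA, htA, hne, nst, hmin, -⟩ := id hst
  have hZi : ∀ {j v}, v ∈ Z i → v ∈ Z j → j = i := by
    intro j v h h'
    by_contra hji
    exact Finset.disjoint_left.1 (hZ hji) h' h
  have viaOne : ∀ x ∈ w.support, (∀ z ∈ Z i, G.Adj x z) → ∃ S : Set V, (G.induce S).Connected ∧
      (Z i : Set V) ⊆ S ∧ ∀ x ∈ S, x ∈ Z i ∨ x ∈ w.support := by
    intro x hx hxz
    refine ⟨insert x (Z i), connected_induce_of_reachable (Set.mem_insert _ _) fun v hv => ?_,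
      Set.subset_insert _ _, ?_⟩
    · rcases id hv with rfl | hv'
      · rfl
      · exact Adj.reachable (G := G.induce _) (hxz v hv')
    · rintro y (rfl | hy)
      · exact .inr hx
      · exact .inl hy
  by_cases hs : G.InTriad s
  · have : ∃ x ∈ w.support, ¬ G.CoClose x s := by
      by_contra! hcon
      -- Target status is constant along a walk inside one piece, yet `t` is a target and `s` is
      -- not.
      have key : ∀ {u v} (w : (G.pathReduction Z).Walk u v), (∀ x ∈ w.support, G.CoClose x s) →
          (G.IsTarget Z u ↔ G.IsTarget Z v) := by
        intro u v w
        induction w with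
        | nil => simp
        | @cons u b v hadj w ih =>
          intro h
          simp only [Walk.support_cons, List.mem_cons, forall_eq_or_imp] at h
          have hb := h.2 b w.start_mem_support
          rw [← ih h.2]
          have hbT := hb.inTriad hG hs
          rcases hadj.2 with h' | h'
          · exact h'.2.2 (h.1.trans hG hbT hb.symm)
          · exact absurd ⟨h.1.inTriad hG hs, hbT⟩ h'.1
      obtain ⟨j, s', h⟩ := (key w hcon).2 ⟨i, s, hst⟩
      obtain rfl := hZi hsA h.2.2.1
      exact h.2.2.2.1 (h.unique hst).1
    obtain ⟨x, hx, hxs⟩ := this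
    exact viaOne x hx fun z hz => adj_of_not_coClose hG hs hxs (hst.coClose hz)
  · by_cases hT : ∃ x ∈ w.support, G.InTriad x
    · obtain ⟨x, hx, hxT⟩ := hT
      exact viaOne x hx fun z hz => hxT.adj_of_not hG (hst.not_inTriad hG hs hz)
    push Not at hT
    let S : Set V := {x | x ∈ Z i ∨ x ∈ w.support}
    -- An added edge is replaced by a two-edge walk through `Z i`: its terminal end lies on `w`, so
    -- it is `s` or `t`.
    have hcomp : ∀ {u v} (hu : u ∈ w.support) (hv : v ∈ w.support), G.AdjComponent Z u v →
        (G.induce S).Reachable ⟨u, .inr hu⟩ ⟨v, .inr hv⟩ := by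
      rintro u v hu hv ⟨j, -, huj, -, y, hy, huy, hyv⟩
      have hui : u ∈ Z i := by rcases hw u hu ⟨j, huj⟩ with rfl | rfl <;> assumption
      obtain rfl := hZi hui huj
      exact (Adj.reachable (G := G.induce S) (u := ⟨u, .inr hu⟩) (v := ⟨y, .inl hy⟩) huy).trans
        (Adj.reachable (G := G.induce S) hyv)
    have hsupp : ∀ x (hx : x ∈ w.support), (G.induce S).Reachable ⟨s, .inl hsA⟩ ⟨x, .inr hx⟩ := by
      intro x hx
      have h1 : ((G.pathReduction Z).induce {x | x ∈ w.support}).Reachable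
          ⟨s, w.start_mem_support⟩ ⟨x, hx⟩ :=
        ⟨(w.takeUntil x hx).induce _ fun y hy => w.support_takeUntil_subset_support hx hy⟩
      refine h1.map_of_adj (H := G.induce S)
        (fun y : {x | x ∈ w.support} => (⟨y.1, .inr y.2⟩ : S)) fun u v huv => ?_
      have huv : (G.pathReduction Z).Adj u v := huv
      rcases huv.2 with h | ⟨-, h | h | h⟩
      · exact absurd h.1 (hT _ u.2)
      · exact Adj.reachable (G := G.induce S) h
      · exact hcomp u.2 v.2 h
      · exact (hcomp v.2 u.2 h).symm
    refine ⟨S, connected_induce_of_reachable (r := s) (.inl hsA) fun v hv => ?_,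
      fun x hx => .inl hx, fun x hx => hx⟩
    rcases id hv with hvZ | hvw
    · have step : ∀ {r} (hr : r ∈ w.support), (v = r ∨ G.Adj v r) →
          (G.induce S).Reachable ⟨s, .inl hsA⟩ ⟨v, hv⟩ := by
        rintro r hr (rfl | h)
        · exact hsupp _ hr
        · exact (hsupp r hr).trans (Adj.reachable (G := G.induce S) h.symm)
      rcases hst.eq_or_adj (z := v) hs with h | h
      · exact step w.start_mem_support h
      · exact step w.end_mem_support h
    · exact hsupp v hvw

end Correctness

end SimpleGraph

/-! ### Correctness for all terminal sets together -/

namespace SimpleGraph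

variable {V ι : Type} {G : SimpleGraph V} [LinearOrder V] {Z : ι → Finset V}

theorem IsTerminalPair.mem_terminalSet {s t x : V} (h : G.IsTerminalPair Z s t)
    (hx : x = s ∨ x = t) : ∃ i, x ∈ Z i ∧ s ∈ Z i ∧ t ∈ Z i := by
  rcases h with ⟨i, h⟩ | ⟨rfl, i, h, -⟩
  · rcases hx with rfl | rfl
    · exact ⟨i, h.2.1, h.2.1, h.2.2.1⟩
    · exact ⟨i, h.2.2.1, h.2.1, h.2.2.1⟩
  · exact ⟨i, by rcases hx with rfl | rfl <;> exact h, h, h⟩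

theorem exists_isTerminalPair {i : ι} {x : V} (hx : x ∈ Z i) :
    ∃ s t, G.IsTerminalPair Z s t ∧ s ∈ Z i ∧ (x = s ∨ x = t) := by
  by_cases h : ∃ w, G.IsSplitPair (Z i) x w ∨ G.IsSplitPair (Z i) w x
  · obtain ⟨w, h | h⟩ := h
    · exact ⟨x, w, .inl ⟨i, h⟩, hx, .inl rfl⟩
    · exact ⟨w, x, .inl ⟨i, h⟩, h.2.1, .inr rfl⟩
  · push Not at h
    exact ⟨x, x, .inr ⟨rfl, i, hx, h⟩, hx, .inl rfl⟩

/-- Canonical pairs are unique in their set and trivial pairs avoid them, so terminal pairs are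
disjoint. -/
theorem IsTerminalPair.eq_of_mem (hZ : Pairwise fun i j => Disjoint (Z i) (Z j)) {s t s' t' x : V}
    (h : G.IsTerminalPair Z s t) (h' : G.IsTerminalPair Z s' t') (hx : x = s ∨ x = t)
    (hx' : x = s' ∨ x = t') : s = s' ∧ t = t' := by
  have hij : ∀ {i j v}, v ∈ Z i → v ∈ Z j → i = j := by
    intro i j v h h'
    by_contra hij
    exact Finset.disjoint_left.1 (hZ hij) h h'
  rcases h with ⟨i, h⟩ | ⟨rfl, i, h, h0⟩ <;> rcases h' with ⟨j, h'⟩ | ⟨rfl, j, h', h0'⟩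
  · have hi : x ∈ Z i := by rcases hx with rfl | rfl; exacts [h.2.1, h.2.2.1]
    have hj : x ∈ Z j := by rcases hx' with rfl | rfl; exacts [h'.2.1, h'.2.2.1]
    obtain rfl := hij hi hj
    exact h.unique h'
  · obtain rfl : x = s' := by simpa using hx'
    have hi : x ∈ Z i := by rcases hx with rfl | rfl; exacts [h.2.1, h.2.2.1]
    obtain rfl := hij hi h'
    rcases hx with rfl | rfl
    · exact absurd h (h0' _).1
    · exact absurd h (h0' _).2
  · obtain rfl : x = s := by simpa using hx
    have hj : x ∈ Z j := by rcases hx' with rfl | rfl; exacts [h'.2.1, h'.2.2.1]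
    obtain rfl := hij h hj
    rcases hx' with rfl | rfl
    · exact absurd h' (h0 _).1
    · exact absurd h' (h0 _).2
  · grind

/-- There are pairwise disjoint connected sets, the `i`-th one containing `Z i`. -/
def HasDisjointConnected (G : SimpleGraph V) (Z : ι → Finset V) : Prop :=
  ∃ S : ι → Finset V, (Pairwise fun i j => Disjoint (S i) (S j)) ∧
    ∀ i, (G.induce (S i : Set V)).Connected ∧ Z i ⊆ S i

/-- The pairs related by `R` can be linked by walks with pairwise disjoint supports. -/
def HasDisjointLinks (G : SimpleGraph V) (R : V → V → Prop) : Prop :=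
  ∃ U : V → V → Set V, (∀ s t, R s t → ∃ w : G.Walk s t, ∀ x ∈ w.support, x ∈ U s t) ∧
    ∀ s t s' t' x, R s t → R s' t' → x ∈ U s t → x ∈ U s' t' → s = s' ∧ t = t'

theorem hasDisjointLinks_of_hasDisjointConnected (hG : G.InducedP3Dominates)
    (hZ : Pairwise fun i j => Disjoint (Z i) (Z j)) (h : G.HasDisjointConnected Z) :
    (G.pathReduction Z).HasDisjointLinks (G.IsTerminalPair Z) := by
  obtain ⟨S, hS, hSZ⟩ := h
  have hnt : ∀ i, ∀ v ∈ S i, v ∉ Z i → ¬ IsTerminal Z v := by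
    rintro i v hv hvi ⟨j, hj⟩
    have hij : i ≠ j := by rintro rfl; exact hvi hj
    exact Finset.disjoint_left.1 (hS hij) hv ((hSZ j).2 hj)
  -- A split pair owns its two ends and the nonterminals of `S i`; the remaining terminals of `Z i`
  -- are left to their trivial pairs.
  refine ⟨fun s t => {x | x = s ∨ x = t ∨ ∃ i, G.IsSplitPair (Z i) s t ∧ x ∈ S i ∧ x ∉ Z i},
    fun s t hst => ?_, fun s t s' t' x hst hst' hx hx' => ?_⟩
  · rcases hst with ⟨i, hst⟩ | ⟨rfl, -⟩
    · obtain ⟨w, hw⟩ := exists_pathReduction_walk hG hst (S := S i) (hSZ i).1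
        (by exact_mod_cast (hSZ i).2) (hnt i)
      refine ⟨w, fun x hx => ?_⟩
      rcases hw x hx with h | h | h
      · exact .inl h
      · exact .inr (.inl h)
      · exact .inr (.inr ⟨i, hst, h⟩)
    · exact ⟨.nil, fun x hx => .inl (by simpa using hx)⟩
  · rcases or_assoc.2 hx with hx | ⟨i, hi, hxi, nxi⟩ <;>
      rcases or_assoc.2 hx' with hx' | ⟨j, hj, hxj, nxj⟩
    · exact hst.eq_of_mem hZ hst' hx hx'
    · obtain ⟨i, hi, -⟩ := hst.mem_terminalSet hx
      exact absurd ⟨i, hi⟩ (hnt j x hxj nxj)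
    · obtain ⟨j, hj, -⟩ := hst'.mem_terminalSet hx'
      exact absurd ⟨j, hj⟩ (hnt i x hxi nxi)
    · obtain rfl : i = j := by
        by_contra hij
        exact Finset.disjoint_left.1 (hS hij) hxi hxj
      exact hi.unique hj

theorem hasDisjointConnected_of_hasDisjointLinks [Fintype V] (hG : G.InducedP3Dominates)
    (hne : ∀ i, (Z i).Nonempty) (hZ : Pairwise fun i j => Disjoint (Z i) (Z j))
    (h : (G.pathReduction Z).HasDisjointLinks (G.IsTerminalPair Z)) :
    G.HasDisjointConnected Z := by
  classical
  obtain ⟨U, hU, hdisj⟩ := h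
  have hij : ∀ {i j v}, v ∈ Z i → v ∈ Z j → i = j := by
    intro i j v h h'
    by_contra hij
    exact Finset.disjoint_left.1 (hZ hij) h h'
  have hmem : ∀ {s t x}, G.IsTerminalPair Z s t → x = s ∨ x = t → x ∈ U s t := by
    rintro s t x hst hx
    obtain ⟨w, hw⟩ := hU s t hst
    rcases hx with rfl | rfl
    · exact hw _ w.start_mem_support
    · exact hw _ w.end_mem_support
  have key : ∀ i, ∃ S : Set V, (G.induce S).Connected ∧ (Z i : Set V) ⊆ S ∧
      ∀ x ∈ S, ∃ s t, G.IsTerminalPair Z s t ∧ s ∈ Z i ∧ x ∈ U s t := by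
    intro i
    have hZU : ∀ x ∈ Z i, ∃ s t, G.IsTerminalPair Z s t ∧ s ∈ Z i ∧ x ∈ U s t := by
      intro x hx
      obtain ⟨s, t, hst, hs, hx⟩ := exists_isTerminalPair (G := G) hx
      exact ⟨s, t, hst, hs, hmem hst hx⟩
    by_cases hsplit : G.IsSplit (Z i)
    · obtain ⟨s, t, hst⟩ := hsplit.exists_isSplitPair
      have hst' : G.IsTerminalPair Z s t := .inl ⟨i, hst⟩
      obtain ⟨w, hw⟩ := hU s t hst'
      obtain ⟨S, hS, hZS, hSw⟩ := exists_connected_of_pathReduction_walk hG hZ hst w (by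
        -- A terminal on `w` also lies in the `U` of its own pair, so that pair is `(s, t)`.
        rintro x hx ⟨j, hj⟩
        obtain ⟨s', t', hst'', -, hx'⟩ := exists_isTerminalPair (G := G) hj
        obtain ⟨rfl, rfl⟩ := hdisj s' t' s t x hst'' hst' (hmem hst'' hx') (hw x hx)
        exact hx')
      refine ⟨S, hS, hZS, fun x hx => ?_⟩
      rcases hSw x hx with h | h
      · exact hZU x h
      · exact ⟨s, t, hst', hst.2.1, hw x h⟩
    · exact ⟨Z i, hG.connected_of_not_isSplit (hne i) hsplit, subset_rfl, hZU⟩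
  choose S hS hZS hSU using key
  refine ⟨fun i => (S i).toFinset, fun i j hne => Finset.disjoint_left.2 fun x hx hx' => ?_,
    fun i => ⟨by rw [Set.coe_toFinset]; exact hS i, fun x hx => by simpa using hZS i hx⟩⟩
  obtain ⟨s, t, hst, hs, hx⟩ := hSU i x (by simpa using hx)
  obtain ⟨s', t', hst', hs', hx'⟩ := hSU j x (by simpa using hx')
  obtain ⟨rfl, rfl⟩ := hdisj s t s' t' x hst hst' hx hx'
  exact hne (hij hs hs')

end SimpleGraph

/-! ### Forbidden induced subgraphs -/

theorem IsHFree.inducedP3Dominates {V : Type} {G : SimpleGraph V} (h : IsHFree graphP1P3 G) :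
    G.InducedP3Dominates := by
  intro x a b c hab hbc hac nac
  by_contra hcon
  push Not at hcon
  obtain ⟨hxa, hxb, hxc⟩ := hcon
  have h1 : x ≠ a := by rintro rfl; exact hxb hab
  have h2 : x ≠ b := by rintro rfl; exact hxc hbc
  have h3 : x ≠ c := by rintro rfl; exact hxb hbc.symm
  have inj : Function.Injective (Sum.elim (fun _ => x) ![a, b, c] : Fin 1 ⊕ Fin 3 → V) := by
    have := hab.ne
    have := hbc.ne
    rintro (u | u) (v | v) huv <;> fin_cases u <;> fin_cases v <;> simp_all
  have hadj : ∀ u v : Fin 1 ⊕ Fin 3, G.Adj (Sum.elim (fun _ => x) ![a, b, c] u)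
      (Sum.elim (fun _ => x) ![a, b, c] v) ↔ graphP1P3.Adj u v := by
    have nax : ¬ G.Adj a x := fun h => hxa h.symm
    have nbx : ¬ G.Adj b x := fun h => hxb h.symm
    have ncx : ¬ G.Adj c x := fun h => hxc h.symm
    have nca : ¬ G.Adj c a := fun h => nac h.symm
    rintro (u | u) (v | v) <;> fin_cases u <;> fin_cases v <;>
      simp [graphP1P3, SimpleGraph.pathGraph_adj, *, hab.symm, hbc.symm]
  exact h ⟨⟨⟨_, inj⟩, fun {u v} => hadj u v⟩⟩

theorem isHFree_graph3P1 {V : Type} {G : SimpleGraph V}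
    (h : ∀ a b c, a ≠ b → b ≠ c → a ≠ c → ¬ G.Adj a b → ¬ G.Adj b c → ¬ G.Adj a c → False) :
    IsHFree graph3P1 G := by
  rintro ⟨f⟩
  refine h (f (.inl (.inl 0))) (f (.inl (.inr 0))) (f (.inr 0)) (f.injective.ne ?_)
    (f.injective.ne ?_) (f.injective.ne ?_) (mt f.map_rel_iff.1 ?_) (mt f.map_rel_iff.1 ?_)
    (mt f.map_rel_iff.1 ?_) <;>
    simp [graph3P1]

theorem graph3P1_isIndContained : SimpleGraph.IsIndContained graph3P1 graphP1P3 := by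
  let e : (Fin 1 ⊕ Fin 1) ⊕ Fin 1 → Fin 1 ⊕ Fin 3 :=
    Sum.elim (Sum.elim (fun _ => .inl 0) fun _ => .inr 0) fun _ => .inr 2
  have inj : Function.Injective e := by
    rintro ((u | u) | u) ((v | v) | v) huv <;> fin_cases u <;> fin_cases v <;> simp_all [e]
  have hadj : ∀ u v, graphP1P3.Adj (e u) (e v) ↔ graph3P1.Adj u v := by
    rintro ((u | u) | u) ((v | v) | v) <;> fin_cases u <;> fin_cases v <;>
      simp [e, graph3P1, graphP1P3, SimpleGraph.pathGraph_adj]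
  exact ⟨⟨⟨e, inj⟩, fun {u v} => hadj u v⟩⟩

theorem IsHFree.mono {W W' V : Type} {H : SimpleGraph W} {H' : SimpleGraph W'} {G : SimpleGraph V}
    (hH : SimpleGraph.IsIndContained H H') (h : IsHFree H G) : IsHFree H' G :=
  fun h' => h (hH.trans h')

/-! ### Predicates that are decidable in polynomial time -/

theorem enc_finRange (n : ℕ) : enc (List.finRange n) = enc (List.range n) := by
  rw [← List.map_coe_finRange_eq_range]
  simp only [enc, List.map_map]
  rfl

theorem PolyTime.finRange {α : Type} [Encoded α] {n : α → ℕ} (hn : PolyTime n) :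
    PolyTime fun a => List.finRange (n a) := by
  have := hn.range
  unfold PolyTime at this ⊢
  simpa only [enc_finRange] using this

open Classical in
/-- The predicate `P` is decidable in polynomial time. -/
def PolyDecidable {α : Type} [Encoded α] (P : α → Prop) : Prop := PolyTime fun a => decide (P a)

namespace PolyDecidable

variable {α : Type} [Encoded α] {P Q : α → Prop}

theorem of_bool {b : α → Bool} (hb : PolyTime b) (h : ∀ a, b a = true ↔ P a) :
    PolyDecidable P := by
  classical
  unfold PolyDecidable
  convert hb using 2 with a
  rw [Bool.eq_iff_iff, decide_eq_true_iff, h]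

theorem and (hP : PolyDecidable P) (hQ : PolyDecidable Q) : PolyDecidable fun a => P a ∧ Q a :=
  of_bool (PolyTime.and hP hQ) (by simp)

theorem not (hP : PolyDecidable P) : PolyDecidable fun a => ¬ P a :=
  of_bool (PolyTime.not hP) (by simp)

theorem or (hP : PolyDecidable P) (hQ : PolyDecidable Q) : PolyDecidable fun a => P a ∨ Q a := by
  simpa only [not_and_or, not_not] using (hP.not.and hQ.not).not

theorem imp (hP : PolyDecidable P) (hQ : PolyDecidable Q) : PolyDecidable fun a => P a → Q a := by
  simpa only [← imp_iff_not_or] using hP.not.or hQ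

theorem iff (hP : PolyDecidable P) (hQ : PolyDecidable Q) :
    PolyDecidable fun a => (P a ↔ Q a) := by
  simpa only [← iff_iff_implies_and_implies] using (hP.imp hQ).and (hQ.imp hP)

/-- Exhaustive search: each bounded quantifier costs one pass over a list of polynomial length. -/
theorem exists_fin {n : α → ℕ} {P : ∀ a, Fin (n a) → Prop} (hn : PolyTime n)
    (hP : PolyDecidable fun p : Σ a, Fin (n a) => P p.1 p.2) :
    PolyDecidable fun a => ∃ v, P a v := by
  classical
  exact of_bool (hn.finRange.any (f := fun a v => decide (P a v))
    (by unfold PolyDecidable at hP; convert hP)) (by simp)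

theorem forall_fin {n : α → ℕ} {P : ∀ a, Fin (n a) → Prop} (hn : PolyTime n)
    (hP : PolyDecidable fun p : Σ a, Fin (n a) => P p.1 p.2) :
    PolyDecidable fun a => ∀ v, P a v := by
  simpa only [not_exists, not_not] using (exists_fin (P := fun a v => ¬ P a v) hn hP.not).not

variable {n : α → ℕ} {u v : ∀ a, Fin (n a)}

theorem le (hu : PolyTime u) (hv : PolyTime v) : PolyDecidable fun a => u a ≤ v a :=
  of_bool (PolyTime.le (m := fun a => (u a : ℕ)) (n := fun a => (v a : ℕ)) hu hv) (by simp)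

theorem eq (hu : PolyTime u) (hv : PolyTime v) : PolyDecidable fun a => u a = v a :=
  of_bool (PolyTime.eq (m := fun a => (u a : ℕ)) (n := fun a => (v a : ℕ)) hu hv)
    (by simp [Fin.ext_iff])

end PolyDecidable

/-! ### Predicates on graphs -/

/-- The 0-1 vector of a set of vertices. -/
def indicatorRow {n : ℕ} (A : Finset (Fin n)) : List Bool :=
  (List.finRange n).map fun v => decide (v ∈ A)

/-- The 0-1 vectors of a family of sets. -/
def indicatorRows {n k : ℕ} (Z : Fin k → Finset (Fin n)) : List (List Bool) :=
  (List.finRange k).map fun i => indicatorRow (Z i)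

open Classical in
/-- The adjacency matrix. -/
noncomputable def adjRows {n : ℕ} (G : SimpleGraph (Fin n)) : List (List Bool) :=
  (List.finRange n).map fun u => (List.finRange n).map fun v => decide (G.Adj u v)

theorem encodeGraph_eq {n : ℕ} (G : SimpleGraph (Fin n)) : encodeGraph G = enc (adjRows G) := by
  simp only [encodeGraph, adjRows, enc, List.map_map, List.ofFn_eq_map, Function.comp_def]

theorem getD_map_finRange {n : ℕ} {β : Type} (f : Fin n → β) (i : Fin n) (d : β) :
    ((List.finRange n).map f).getD i d = f i := by
  simp [List.getD_eq_getElem?_getD]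

section Graph

variable {α : Type} [Encoded α] {n k : α → ℕ} {G : ∀ a, SimpleGraph (Fin (n a))}
  {A : ∀ a, Finset (Fin (n a))} {Z : ∀ a, Fin (k a) → Finset (Fin (n a))}
  {u v : ∀ a, Fin (n a)} {i : ∀ a, Fin (k a)}

theorem PolyTime.order (hG : PolyTime fun a => adjRows (G a)) : PolyTime n := by
  simpa [adjRows] using hG.length

theorem PolyTime.card_family (hZ : PolyTime fun a => indicatorRows (Z a)) : PolyTime k := by
  simpa [indicatorRows] using hZ.length

theorem PolyTime.row (hZ : PolyTime fun a => indicatorRows (Z a)) (hi : PolyTime i) :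
    PolyTime fun a => indicatorRow (Z a (i a)) := by
  have := hZ.getD (n := fun a => (i a : ℕ)) (d := []) hi rfl
  simpa only [indicatorRows, getD_map_finRange] using this

namespace PolyDecidable

theorem mem (hA : PolyTime fun a => indicatorRow (A a)) (hv : PolyTime v) :
    PolyDecidable fun a => v a ∈ A a :=
  of_bool (hA.getD (n := fun a => (v a : ℕ)) (d := false) hv rfl)
    (by simp [indicatorRow])

theorem isTerminal (hZ : PolyTime fun a => indicatorRows (Z a)) (hv : PolyTime v) :
    PolyDecidable fun a => SimpleGraph.IsTerminal (Z a) (v a) :=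
  exists_fin hZ.card_family (mem (hZ.weaken.row PolyTime.sigma_snd) hv.weaken)

variable (hG : PolyTime fun a => adjRows (G a))
include hG

theorem adj (hu : PolyTime u) (hv : PolyTime v) : PolyDecidable fun a => (G a).Adj (u a) (v a) :=
  of_bool ((hG.getD (n := fun a => (u a : ℕ)) (d := []) hu rfl).getD (n := fun a => (v a : ℕ))
    (d := false) hv rfl) (by simp [adjRows])

theorem inTriad (hv : PolyTime v) : PolyDecidable fun a => (G a).InTriad (v a) := by
  have hG2 := (hG.weaken (β := fun a => Fin (n a))).weaken (β := fun p => Fin (n p.1))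
  have hv2 := (hv.weaken (β := fun a => Fin (n a))).weaken (β := fun p => Fin (n p.1))
  have ha := (PolyTime.sigma_snd (β := fun a => Fin (n a))).weaken (β := fun p => Fin (n p.1))
  have hb := PolyTime.sigma_snd (β := fun p : Σ a, Fin (n a) => Fin (n p.1))
  exact exists_fin hG.order (exists_fin hG.order.weaken
    ((eq hv2 ha).not.and <| (eq hv2 hb).not.and <| (eq ha hb).not.and <|
      (adj hG2 hv2 ha).not.and <| (adj hG2 hv2 hb).not.and (adj hG2 ha hb).not))

theorem coClose (hu : PolyTime u) (hv : PolyTime v) :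
    PolyDecidable fun a => (G a).CoClose (u a) (v a) :=
  exists_fin hG.order ((adj hG.weaken hu.weaken PolyTime.sigma_snd).not.and
    (adj hG.weaken hv.weaken PolyTime.sigma_snd).not)

theorem isSplit (hA : PolyTime fun a => indicatorRow (A a)) :
    PolyDecidable fun a => (G a).IsSplit (A a) := by
  have hu := PolyTime.sigma_snd (β := fun a => Fin (n a))
  have hG1 := hG.weaken (β := fun a => Fin (n a))
  have hA1 := hA.weaken (β := fun a => Fin (n a))
  have hG2 := hG1.weaken (β := fun p => Fin (n p.1))
  have hA2 := hA1.weaken (β := fun p => Fin (n p.1))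
  have hu2 := hu.weaken (β := fun p => Fin (n p.1))
  have hv2 := PolyTime.sigma_snd (β := fun p : Σ a, Fin (n a) => Fin (n p.1))
  have hG3 := hG2.weaken (β := fun p => Fin (n p.1.1))
  have hA3 := hA2.weaken (β := fun p => Fin (n p.1.1))
  have hu3 := hu2.weaken (β := fun p => Fin (n p.1.1))
  have hv3 := hv2.weaken (β := fun p => Fin (n p.1.1))
  have hw3 := PolyTime.sigma_snd (β := fun p : Σ p : Σ a, Fin (n a), Fin (n p.1) => Fin (n p.1.1))
  refine and (exists_fin hG.order ((mem hA1 hu).and (exists_fin hG1.order ((mem hA2 hv2).and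
    ((eq hu2 hv2).not.and (adj hG2 hu2 hv2).not))))) ?_
  exact forall_fin hG.order ((mem hA1 hu).imp (forall_fin hG1.order ((mem hA2 hv2).imp
    (forall_fin hG2.order ((mem hA3 hw3).imp ((adj hG3 hu3 hv3).imp ((adj hG3 hv3 hw3).imp
      ((eq hu3 hw3).not.imp (adj hG3 hu3 hw3)))))))))

theorem isSplitPair (hA : PolyTime fun a => indicatorRow (A a)) (hu : PolyTime u)
    (hv : PolyTime v) : PolyDecidable fun a => (G a).IsSplitPair (A a) (u a) (v a) :=
  have hw := PolyTime.sigma_snd (β := fun a => Fin (n a))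
  (isSplit hG hA).and <| (mem hA hu).and <| (mem hA hv).and <| (eq hu hv).not.and <|
    (adj hG hu hv).not.and <| and
      (forall_fin hG.order ((mem hA.weaken hw).imp (le hu.weaken hw)))
      (forall_fin hG.order ((mem hA.weaken hw).imp ((eq hw hu.weaken).not.imp
        ((adj hG.weaken hu.weaken hw).not.imp (le hv.weaken hw)))))

variable (hZ : PolyTime fun a => indicatorRows (Z a))
include hZ

theorem isTarget (hv : PolyTime v) : PolyDecidable fun a => (G a).IsTarget (Z a) (v a) :=
  exists_fin hZ.card_family (exists_fin hG.order.weaken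
    (isSplitPair hG.weaken.weaken (hZ.weaken.row PolyTime.sigma_snd).weaken PolyTime.sigma_snd
      hv.weaken.weaken))

theorem isTerminalPair (hu : PolyTime u) (hv : PolyTime v) :
    PolyDecidable fun a => (G a).IsTerminalPair (Z a) (u a) (v a) :=
  (exists_fin hZ.card_family
    (isSplitPair hG.weaken (hZ.weaken.row PolyTime.sigma_snd) hu.weaken hv.weaken)).or <|
  (eq hu hv).and <| exists_fin hZ.card_family <|
    (mem (hZ.weaken.row PolyTime.sigma_snd) hu.weaken).and <| forall_fin hG.order.weaken <| and
      (isSplitPair hG.weaken.weaken (hZ.weaken.row PolyTime.sigma_snd).weaken hu.weaken.weaken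
        PolyTime.sigma_snd).not
      (isSplitPair hG.weaken.weaken (hZ.weaken.row PolyTime.sigma_snd).weaken
        PolyTime.sigma_snd hu.weaken.weaken).not

theorem adjComponent (hu : PolyTime u) (hv : PolyTime v) :
    PolyDecidable fun a => (G a).AdjComponent (Z a) (u a) (v a) :=
  have hrow := hZ.weaken.row (PolyTime.sigma_snd (β := fun a => Fin (k a)))
  exists_fin hZ.card_family <| (isSplit hG.weaken hrow).and <| (mem hrow hu.weaken).and <|
    (isTerminal hZ.weaken hv.weaken).not.and <| exists_fin hG.order.weaken <|
      (mem hrow.weaken PolyTime.sigma_snd).and <|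
        (adj hG.weaken.weaken hu.weaken.weaken PolyTime.sigma_snd).and
          (adj hG.weaken.weaken PolyTime.sigma_snd hv.weaken.weaken)

theorem pathReduction_adj (hu : PolyTime u) (hv : PolyTime v) :
    PolyDecidable fun a => ((G a).pathReduction (Z a)).Adj (u a) (v a) :=
  (eq hu hv).not.and <| or
    ((inTriad hG hu).and <| (inTriad hG hv).and <| (coClose hG hu hv).imp <|
      (isTarget hG hZ hu).iff (isTarget hG hZ hv))
    (((inTriad hG hu).and (inTriad hG hv)).not.and <| (adj hG hu hv).or <|
      (adjComponent hG hZ hu hv).or (adjComponent hG hZ hv hu))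

end PolyDecidable

end Graph

/-! ### The reductions -/

theorem DecisionProblem.PolyReducesTo.trans {A B C : DecisionProblem} (h : A.PolyReducesTo B)
    (h' : B.PolyReducesTo C) : A.PolyReducesTo C := by
  obtain ⟨f, hf, hyes⟩ := h
  obtain ⟨g, hg, hyes'⟩ := h'
  have hf : Transforms A.encode fun a => B.encode (f a) := hf
  have hg : Transforms B.encode fun b => C.encode (g b) := hg
  exact ⟨fun a => g (f a), hf.trans (hg.comap f), fun I => (hyes I).trans (hyes' _)⟩

namespace DisjointPathsInstance

noncomputable instance : Encoded DisjointPathsInstance := ⟨disjointPaths.encode⟩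

/-- The list of terminal pairs. -/
def pairs (I : DisjointPathsInstance) : List (Fin I.n × Fin I.n) :=
  (List.finRange I.k).map fun i => (I.s i, I.t i)

theorem enc_eq (I : DisjointPathsInstance) :
    enc I = Data.cons (enc (adjRows I.G)) (enc I.pairs) := by
  change Data.cons (encodeGraph I.G) _ = _
  rw [encodeGraph_eq]
  simp only [pairs, enc, List.map_map, List.ofFn_eq_map, Function.comp_def]

theorem polyTime_adjRows : PolyTime fun I : DisjointPathsInstance => adjRows I.G := by
  have := (Transforms.refl (enc : DisjointPathsInstance → Data)).hd
  unfold PolyTime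
  simpa only [enc_eq, Data.hd] using this

theorem polyTime_pairs : PolyTime pairs := by
  have := (Transforms.refl (enc : DisjointPathsInstance → Data)).tl
  unfold PolyTime
  simpa only [enc_eq, Data.tl] using this

/-- `toPath` only shrinks the support, so walks suffice; disjointness of the terminal pairs lets
each pair stand for its index. -/
theorem yes_iff (I : DisjointPathsInstance) :
    disjointPaths.Yes I ↔ I.G.HasDisjointLinks fun s t => ∃ i, I.s i = s ∧ I.t i = t := by
  classical
  constructor
  · rintro ⟨P, hP⟩
    refine ⟨fun s t => {x | ∃ i, I.s i = s ∧ I.t i = t ∧ x ∈ (P i).1.support}, ?_, ?_⟩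
    · rintro _ _ ⟨i, rfl, rfl⟩
      exact ⟨(P i).1, fun x hx => ⟨i, rfl, rfl, hx⟩⟩
    · rintro _ _ _ _ x - - ⟨i, rfl, rfl, hi⟩ ⟨j, rfl, rfl, hj⟩
      obtain rfl : i = j := by
        by_contra hij
        exact hP hij hi hj
      exact ⟨rfl, rfl⟩
  · rintro ⟨U, hU, hdisj⟩
    choose w hw using fun i => hU _ _ ⟨i, rfl, rfl⟩
    refine ⟨fun i => (w i).toPath, fun i j hij x hi hj => ?_⟩
    have := hdisj _ _ _ _ x ⟨i, rfl, rfl⟩ ⟨j, rfl, rfl⟩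
      (hw i x ((w i).support_toPath_subset_support hi)) (hw j x ((w j).support_toPath_subset_support hj))
    exact Finset.disjoint_left.1 (I.disjoint hij) (Finset.mem_insert_self _ _)
      (this.1 ▸ Finset.mem_insert_self _ _)

/-- Terminal pairs as terminal sets. -/
def toConnectedSubgraphs (I : DisjointPathsInstance) : DisjointConnectedSubgraphsInstance where
  n := I.n
  G := I.G
  k := I.k
  Z i := {I.s i, I.t i}
  nonempty _ := Finset.insert_nonempty _ _
  disjoint := I.disjoint

theorem yes_toConnectedSubgraphs (I : DisjointPathsInstance) :
    disjointPaths.Yes I ↔ disjointConnectedSubgraphs.Yes I.toConnectedSubgraphs := by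
  classical
  change _ ↔ ∃ S : Fin I.k → Finset (Fin I.n), (Pairwise fun i j => Disjoint (S i) (S j)) ∧
    ∀ i, (I.G.induce (S i : Set (Fin I.n))).Connected ∧ ({I.s i, I.t i} : Finset _) ⊆ S i
  constructor
  · rintro ⟨P, hP⟩
    refine ⟨fun i => (P i).1.support.toFinset, fun i j hij => ?_, fun i => ⟨?_, ?_⟩⟩
    · exact Finset.disjoint_left.2 fun x hx hx' =>
        hP hij (List.mem_toFinset.1 hx) (List.mem_toFinset.1 hx')
    · rw [List.coe_toFinset]
      exact (P i).1.connected_induce_support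
    · simp [Finset.insert_subset_iff]
  · rintro ⟨S, hS, hSZ⟩
    have key : ∀ i, ∃ w : I.G.Walk (I.s i) (I.t i), ∀ x ∈ w.support, x ∈ S i := by
      intro i
      have h := (hSZ i).2
      simp only [Finset.insert_subset_iff, Finset.singleton_subset_iff] at h
      exact ((hSZ i).1.preconnected ⟨I.s i, h.1⟩ ⟨I.t i, h.2⟩).exists_walk_of_induce
    choose w hw using key
    refine ⟨fun i => (w i).toPath, fun i j hij x hi hj => ?_⟩
    exact Finset.disjoint_left.1 (hS hij) (hw i x ((w i).support_toPath_subset_support hi))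
      (hw j x ((w j).support_toPath_subset_support hj))

end DisjointPathsInstance

namespace DisjointConnectedSubgraphsInstance

noncomputable instance : Encoded DisjointConnectedSubgraphsInstance :=
  ⟨disjointConnectedSubgraphs.encode⟩

theorem enc_eq (I : DisjointConnectedSubgraphsInstance) :
    enc I = Data.cons (enc (adjRows I.G)) (enc (indicatorRows I.Z)) := by
  change Data.cons (encodeGraph I.G) _ = _
  rw [encodeGraph_eq]
  simp only [indicatorRows, indicatorRow, enc, List.map_map, List.ofFn_eq_map, Function.comp_def]

theorem polyTime_adjRows :
    PolyTime fun I : DisjointConnectedSubgraphsInstance => adjRows I.G := by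
  have := (Transforms.refl (enc : DisjointConnectedSubgraphsInstance → Data)).hd
  unfold PolyTime
  simpa only [enc_eq, Data.hd] using this

theorem polyTime_indicatorRows :
    PolyTime fun I : DisjointConnectedSubgraphsInstance => indicatorRows I.Z := by
  have := (Transforms.refl (enc : DisjointConnectedSubgraphsInstance → Data)).tl
  unfold PolyTime
  simpa only [enc_eq, Data.tl] using this

open Classical in
/-- The list of the terminal pairs to which the terminal sets are reduced. -/
noncomputable def terminalPairs (I : DisjointConnectedSubgraphsInstance) :
    List (Fin I.n × Fin I.n) :=
  ((List.finRange I.n).flatMap fun u => (List.finRange I.n).map fun v => (u, v)).filter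
    fun p => decide (I.G.IsTerminalPair I.Z p.1 p.2)

theorem mem_terminalPairs {I : DisjointConnectedSubgraphsInstance} {p : Fin I.n × Fin I.n} :
    p ∈ I.terminalPairs ↔ I.G.IsTerminalPair I.Z p.1 p.2 := by
  simp [terminalPairs]

/-- Distinct positions then carry distinct pairs, which makes the constructed terminal pairs
disjoint. -/
theorem nodup_terminalPairs (I : DisjointConnectedSubgraphsInstance) : I.terminalPairs.Nodup :=
  ((List.nodup_finRange _).product (List.nodup_finRange _)).filter _

/-- The instance of Disjoint Paths to which an instance of Disjoint Connected Subgraphs is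
reduced. -/
noncomputable def toDisjointPaths (I : DisjointConnectedSubgraphsInstance) :
    DisjointPathsInstance where
  n := I.n
  G := I.G.pathReduction I.Z
  k := I.terminalPairs.length
  s i := (I.terminalPairs.get i).1
  t i := (I.terminalPairs.get i).2
  disjoint i j hij := Finset.disjoint_left.2 fun x hx hx' => hij <| by
    have h := (mem_terminalPairs.1 (I.terminalPairs.get_mem i)).eq_of_mem I.disjoint
      (mem_terminalPairs.1 (I.terminalPairs.get_mem j)) (by simpa using hx) (by simpa using hx')
    exact I.nodup_terminalPairs.injective_get (Prod.ext h.1 h.2)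

theorem pairs_toDisjointPaths (I : DisjointConnectedSubgraphsInstance) :
    I.toDisjointPaths.pairs = I.terminalPairs := by
  change (List.finRange I.terminalPairs.length).map I.terminalPairs.get = _
  simp

theorem yes_toDisjointPaths (I : DisjointConnectedSubgraphsInstance)
    (hG : I.G.InducedP3Dominates) :
    disjointConnectedSubgraphs.Yes I ↔ disjointPaths.Yes I.toDisjointPaths := by
  have key : (fun s t => ∃ i, I.toDisjointPaths.s i = s ∧ I.toDisjointPaths.t i = t) =
      I.G.IsTerminalPair I.Z := by
    ext s t
    rw [← mem_terminalPairs (p := (s, t)), List.mem_iff_get]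
    simp only [Prod.ext_iff]
    rfl
  rw [DisjointPathsInstance.yes_iff, key]
  exact ⟨SimpleGraph.hasDisjointLinks_of_hasDisjointConnected hG I.disjoint,
    SimpleGraph.hasDisjointConnected_of_hasDisjointLinks hG I.nonempty I.disjoint⟩

theorem polyTime_toDisjointPaths : PolyTime toDisjointPaths := by
  classical
  have hG := polyTime_adjRows
  have hZ := polyTime_indicatorRows
  have hV := hG.order.finRange
  have h1 : PolyTime fun I : DisjointConnectedSubgraphsInstance =>
      adjRows (I.G.pathReduction I.Z) :=
    hV.map (hV.weaken.map
      (PolyDecidable.pathReduction_adj hG.weaken.weaken hZ.weaken.weaken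
        PolyTime.sigma_snd.weaken PolyTime.sigma_snd))
  have h2 : PolyTime terminalPairs := by
    refine PolyTime.filter (hV.flatMap (hV.weaken.map
      (PolyTime.sigma_snd.weaken.pair PolyTime.sigma_snd))) ?_
    exact PolyDecidable.isTerminalPair hG.weaken hZ.weaken PolyTime.sigma_snd.fst
      PolyTime.sigma_snd.snd
  unfold PolyTime
  simp only [DisjointPathsInstance.enc_eq, pairs_toDisjointPaths]
  exact Transforms.pair h1 h2

end DisjointConnectedSubgraphsInstance

theorem DisjointPathsInstance.polyTime_toConnectedSubgraphs : PolyTime toConnectedSubgraphs := by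
  have hV := polyTime_adjRows.order.finRange
  have h : PolyTime fun I : DisjointPathsInstance => indicatorRows I.toConnectedSubgraphs.Z := by
    have hmem : PolyDecidable fun q : Σ q : Σ I : DisjointPathsInstance, Fin I.n × Fin I.n,
        Fin q.1.n => q.2 = q.1.2.1 ∨ q.2 = q.1.2.2 :=
      have hp := PolyTime.sigma_snd (β := fun I : DisjointPathsInstance => Fin I.n × Fin I.n)
      .or (.eq PolyTime.sigma_snd hp.fst.weaken) (.eq PolyTime.sigma_snd hp.snd.weaken)
    have := polyTime_pairs.map (f := fun I p => indicatorRow {p.1, p.2}) (hV.weaken.map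
      (by unfold PolyDecidable at hmem; convert hmem using 3; simp))
    simpa [pairs, indicatorRows, toConnectedSubgraphs, Function.comp_def] using this
  unfold PolyTime
  simp only [DisjointConnectedSubgraphsInstance.enc_eq]
  exact Transforms.pair polyTime_adjRows h

theorem disjointPathsOn_polyReducesTo_disjointConnectedSubgraphsOn {W : Type}
    (H : SimpleGraph W) : (disjointPathsOn H).PolyReducesTo (disjointConnectedSubgraphsOn H) :=
  ⟨fun I => ⟨I.1.toConnectedSubgraphs, I.2⟩,
    Transforms.comap DisjointPathsInstance.polyTime_toConnectedSubgraphs Subtype.val,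
    fun I => I.1.yes_toConnectedSubgraphs⟩

theorem disjointConnectedSubgraphsOn_polyReducesTo_disjointPathsOn :
    (disjointConnectedSubgraphsOn graphP1P3).PolyReducesTo (disjointPathsOn graph3P1) :=
  ⟨fun I => ⟨I.1.toDisjointPaths, isHFree_graph3P1 fun _ _ _ hab hbc hac nab nbc nac =>
      SimpleGraph.pathReduction_triad hab hbc hac nab nbc nac I.2.inducedP3Dominates⟩,
    Transforms.comap DisjointConnectedSubgraphsInstance.polyTime_toDisjointPaths Subtype.val,
    fun I => I.1.yes_toDisjointPaths I.2.inducedP3Dominates⟩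

theorem disjointPathsOn_polyReducesTo_of_isIndContained {W W' : Type} {H : SimpleGraph W}
    {H' : SimpleGraph W'} (h : SimpleGraph.IsIndContained H H') :
    (disjointPathsOn H).PolyReducesTo (disjointPathsOn H') :=
  ⟨fun I => ⟨I.1, I.2.mono h⟩, Transforms.refl _, fun _ => Iff.rfl⟩

theorem mainTheorem8 :
    DecisionProblem.PolyEquivalent
        (disjointPathsOn graphP1P3) (disjointPathsOn graph3P1) ∧
      DecisionProblem.PolyEquivalent
        (disjointConnectedSubgraphsOn graphP1P3) (disjointPathsOn graph3P1) :=
  have h1 := disjointPathsOn_polyReducesTo_disjointConnectedSubgraphsOn graphP1P3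
  have h2 := disjointConnectedSubgraphsOn_polyReducesTo_disjointPathsOn
  have h3 := disjointPathsOn_polyReducesTo_of_isIndContained graph3P1_isIndContained
  ⟨⟨h1.trans h2, h3⟩, ⟨h2, h3.trans h1⟩⟩
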